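/- Definitions. A transaction database $\mathcal D$ over a set of items is a finite list of itemsets (finite sets of items). The frequency $\mathrm{fr}(X,\mathcal D)$ of an itemset $X$ is the fraction of the transactions of $\mathcal D$ that contain $X$, and $\mathcal F(\sigma,\mathcal D)$ is the collection of the itemsets with frequency at least $\sigma\in(0,1]$. A change profile is a partial function from itemsets to numbers. The specializing change profile of $X\in\mathcal F(\sigma,\mathcal D)$ maps each $Y$ with $X\cup Y\in\mathcal F(\sigma,\mathcal D)$ to $\mathrm{fr}(X\cup Y,\mathcal D)/\mathrm{fr}(X,\mathcal D)$; the simple specializing change profile of $X$ is its restriction to the singletons $Y$ with $X\cap Y=\emptyset$. A distance function $d$ on change profiles is a real-valued function such that $d(p,q)=0$ if and only if $p$ and $q$ agree on their common domain. The change profile packing problem asks, given a finite collection of change profiles and a distance function $d$, for a partition of the collection into the smallest possible number of groups such that $d(p,q)=0$ for all $p,q$ in the same group. The minimum graph coloring problem asks, given a finite simple graph, for a labeling of its vertices with the smallest possible number of different labels such that adjacent vertices get different labels. Theorem. The change profile packing problem is at least as hard as the minimum graph coloring problem, already for collections of simple specializing change profiles. Precisely: there are a map, computable in polynomial time, that takes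 every finite simple graph $G$ to a nonempty transaction database $\mathcal D$, a threshold $\sigma\in(0,1]$ and the explicitly listed collection $\mathcal Ch$ of the simple specializing change profiles of all itemsets in $\mathcal F(\sigma,\mathcal D)$, and a map, computable in polynomial time, that takes $G$ and a labeling of the members of $\mathcal Ch$ by groups to a labeling of the vertices of $G$, such that for every graph $G$ and every distance function $d$ the following hold. 1. For every integer $k\ge 0$, $\mathcal Ch$ can be partitioned into at most $k+2$ groups with zero pairwise distances within each group if and only if $G$ is $k$-colorable. 2. Every partition of $\mathcal Ch$ into groups with zero pairwise distances is taken to a labeling of $G$ in which adjacent vertices get different labels, and if the partition has at most $k+2$ groups, then the labeling uses at most $k$ different labels. 3. Every solution of the change profile packing problem for $(\mathcal Ch,d)$ is taken to a solution of the minimum graph coloring problem for $G$. -/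

import Mathlib

namespace ChangeProfilePacking

/-! ### Transaction databases and change profiles -/

/-- Items are natural numbers; an itemset is a finite set of items. -/
abbrev Itemset := Finset ℕ

/-- A transaction database whose transaction identifiers are `1, …, |D|`: the entry in position `i`
of the list is the itemset of the `i`-th transaction. -/
abbrev TransactionDB := List Itemset

/-- The support of `X` in `D`: the number of transactions that contain all items of `X`. -/
def support (D : TransactionDB) (X : Itemset) : ℕ := D.countP (fun t => decide (X ⊆ t))

/-- The frequency of `X` in `D`. -/
def freq (D : TransactionDB) (X : Itemset) : ℚ := (support D X : ℚ) / (D.length : ℚ)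

/-- `X` is a `σ`-frequent itemset in `D`. -/
def IsFrequent (σ : ℚ) (D : TransactionDB) (X : Itemset) : Prop := σ ≤ freq D X

instance (σ : ℚ) (D : TransactionDB) (X : Itemset) : Decidable (IsFrequent σ D X) :=
  inferInstanceAs (Decidable (σ ≤ freq D X))

/-- A change profile is a partial function from itemsets to rational numbers; its domain consists of
the itemsets whose value is not `none`. -/
abbrev ChangeProfile := Itemset → Option ℚ

/-- The specializing change profile of `X`: it is defined at the `Y` for which `X ∪ Y` is
`σ`-frequent, and its value there is the accuracy `fr(X ∪ Y) / fr(X)`. -/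
def specializing (σ : ℚ) (D : TransactionDB) (X : Itemset) : ChangeProfile := fun Y =>
  if IsFrequent σ D (X ∪ Y) then some (freq D (X ∪ Y) / freq D X) else none

/-- The concise specializing change profile: the restriction to the `Y` disjoint from `X`. -/
def conciseSpecializing (σ : ℚ) (D : TransactionDB) (X : Itemset) : ChangeProfile := fun Y =>
  if X ∩ Y = ∅ then specializing σ D X Y else none

/-- The simple specializing change profile: the restriction of the concise one to singletons. -/
def simpleSpecializing (σ : ℚ) (D : TransactionDB) (X : Itemset) : ChangeProfile := fun Y =>
  if Y.card = 1 then conciseSpecializing σ D X Y else none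

/-- A distance function between change profiles: `d p q = 0` if and only if `p` and `q` have the
same values on their common domain. -/
def IsDistance (d : ChangeProfile → ChangeProfile → ℝ) : Prop :=
  ∀ p q, d p q = 0 ↔ ∀ Y a b, p Y = some a → q Y = some b → a = b

/-! ### Explicit instances -/

/-- A nonnegative fraction, given by its numerator and its denominator (not necessarily in lowest
terms). -/
abbrev Fraction := ℕ × ℕ

/-- The rational number that a fraction stands for. -/
def Fraction.val (r : Fraction) : ℚ := (r.1 : ℚ) / (r.2 : ℚ)

/-- An instance of frequent itemset mining, written out explicitly: a minimum frequency threshold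
and a list of transactions, each one given by a list of its items. -/
abbrev MiningInstance := Fraction × List (List ℕ)

/-- The threshold of a mining instance. -/
def MiningInstance.threshold (M : MiningInstance) : ℚ := Fraction.val M.1

/-- The transaction database of a mining instance. -/
def MiningInstance.db (M : MiningInstance) : TransactionDB := M.2.map List.toFinset

/-- A legal mining instance has at least one transaction and a threshold in `(0, 1]`. -/
def MiningInstance.IsLegal (M : MiningInstance) : Prop :=
  M.2 ≠ [] ∧ 0 < MiningInstance.threshold M ∧ MiningInstance.threshold M ≤ 1

/-- A change profile, written out explicitly as a table of arguments and values. -/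
abbrev ProfileTable := List (List ℕ × Fraction)

/-- The change profile given by a table. -/
def ProfileTable.profile (T : ProfileTable) : ChangeProfile := fun Y =>
  (T.find? (fun r => decide (r.1.toFinset = Y))).map (fun r => Fraction.val r.2)

/-- An instance of change profile packing: a finite collection of change profiles, each one written
out explicitly and preceded by the itemset that it belongs to. -/
abbrev PackingInstance := List (List ℕ × ProfileTable)

/-- The change profile in position `i` of a packing instance. -/
def PackingInstance.profile (C : PackingInstance) (i : Fin C.length) : ChangeProfile :=
  ProfileTable.profile (C.get i).2

/-- `C` is the collection of the simple specializing change profiles of the frequent itemsets of the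
mining instance `M`: every frequent itemset is listed exactly once, together with its profile, and
nothing else is listed. -/
def IsSimpleProfileCollection (M : MiningInstance) (C : PackingInstance) : Prop :=
  (C.map (fun e => e.1.toFinset)).Nodup ∧
  (∀ X : Itemset, X ∈ C.map (fun e => e.1.toFinset) ↔
    IsFrequent (MiningInstance.threshold M) (MiningInstance.db M) X) ∧
  ∀ e ∈ C, ProfileTable.profile e.2 =
    simpleSpecializing (MiningInstance.threshold M) (MiningInstance.db M) e.1.toFinset

/-! ### Change profile packing -/

/-- The number of different labels in a list. Labels stand for groups or for colors. -/
def numLabels (P : List ℕ) : ℕ := P.toFinset.card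

/-- `P` is a partition of the collection `C` into groups of pairwise distance zero: `P` assigns a
label to every position of `C`, and the groups are the (nonempty) classes of positions with
the same label. The number of groups is `numLabels P`. -/
def IsPacking (d : ChangeProfile → ChangeProfile → ℝ) (C : PackingInstance) (P : List ℕ) : Prop :=
  P.length = C.length ∧
  ∀ i j : Fin C.length, P.getD i 0 = P.getD j 0 →
    d (PackingInstance.profile C i) (PackingInstance.profile C j) = 0

/-- `C` can be packed into (at most) `m` groups. -/
def Packable (d : ChangeProfile → ChangeProfile → ℝ) (C : PackingInstance) (m : ℕ) : Prop :=
  ∃ P, IsPacking d C P ∧ numLabels P ≤ m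

/-- `P` is a solution of the change profile packing problem: a packing with the smallest possible
number of groups. -/
def IsOptimalPacking (d : ChangeProfile → ChangeProfile → ℝ) (C : PackingInstance) (P : List ℕ) :
    Prop :=
  IsPacking d C P ∧ ∀ Q, IsPacking d C Q → numLabels P ≤ numLabels Q

/-! ### Minimum graph coloring -/

/-- A finite simple graph with vertices `0, …, n - 1`. -/
structure FinGraph where
  /-- the number of vertices -/
  n : ℕ
  /-- the graph -/
  graph : SimpleGraph (Fin n)

/-- `c` is a proper labeling of the vertices of `G`: entry `v` of `c` is the label of vertex `v`. -/
def IsProperLabeling (G : FinGraph) (c : List ℕ) : Prop :=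
  c.length = G.n ∧ ∀ u v : Fin G.n, G.graph.Adj u v → c.getD u 0 ≠ c.getD v 0

/-- `c` is a solution of the minimum graph coloring problem: a proper labeling with the smallest
possible number of different labels. -/
def IsMinimumColoring (G : FinGraph) (c : List ℕ) : Prop :=
  IsProperLabeling G c ∧ ∀ c', IsProperLabeling G c' → numLabels c ≤ numLabels c'

/-! ### Encodings as strings

Each encoding `e` below satisfies `PrefixCode e`; in particular it is injective. -/

/-- The alphabet: Mathlib's six-letter Turing machine alphabet. -/
abbrev Sym := Computability.Γ'

/-- `e` is uniquely decodable from left to right. -/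
def PrefixCode {α : Type} (e : α → List Sym) : Prop :=
  ∀ a b s t, e a ++ s = e b ++ t → a = b ∧ s = t

/-- A prefix code is injective. -/
theorem PrefixCode.injective {α : Type} {e : α → List Sym} (h : PrefixCode e) :
    Function.Injective e := fun a b hab => (h a b [] [] (by rw [hab])).1

/-- One bit. -/
def encBool (b : Bool) : List Sym := [Computability.Γ'.bit b]

/-- A natural number in unary. -/
def encNat (n : ℕ) : List Sym :=
  List.replicate n (Computability.Γ'.bit true) ++ [Computability.Γ'.comma]

/-- A pair: one code after the other. -/
def encPair {α β : Type} (ea : α → List Sym) (eb : β → List Sym) (p : α × β) : List Sym :=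
  ea p.1 ++ eb p.2

/-- A list: every entry is announced by an opening bracket, and a closing bracket ends the list. -/
def encList {α : Type} (ea : α → List Sym) (l : List α) : List Sym :=
  l.flatMap (fun a => Computability.Γ'.bra :: ea a) ++ [Computability.Γ'.ket]

/-- The adjacency matrix of a graph, as a list of rows of bits. -/
noncomputable def FinGraph.matrix (G : FinGraph) : List (List Bool) :=
  open Classical in
  List.ofFn fun u : Fin G.n => List.ofFn fun v : Fin G.n => decide (G.graph.Adj u v)

/-- A graph is encoded by its adjacency matrix. -/
noncomputable def encGraph (G : FinGraph) : List Sym := encList (encList encBool) G.matrix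

/-- A list of natural numbers: an itemset, or a list of labels. -/
def encNats : List ℕ → List Sym := encList encNat

/-- A fraction. -/
def encFraction : Fraction → List Sym := encPair encNat encNat

/-- A mining instance. -/
def encMining : MiningInstance → List Sym := encPair encFraction (encList encNats)

/-- A packing instance. -/
def encPacking : PackingInstance → List Sym :=
  encList (encPair encNats (encList (encPair encNats encFraction)))

theorem prefixCode_encBool : PrefixCode encBool := by
  intro a b s t h
  simpa [encBool] using h

theorem prefixCode_encNat : PrefixCode encNat := by
  intro a
  induction a with
  | zero =>
    intro b s t h
    cases b with
    | zero => simpa [encNat] using h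
    | succ b => simp [encNat, List.replicate_succ] at h
  | succ a ih =>
    intro b s t h
    cases b with
    | zero => simp [encNat, List.replicate_succ] at h
    | succ b =>
      have h' : encNat a ++ s = encNat b ++ t := by
        simpa [encNat, List.replicate_succ] using h
      obtain ⟨h1, h2⟩ := ih b s t h'
      exact ⟨by rw [h1], h2⟩

theorem prefixCode_encPair {α β : Type} {ea : α → List Sym} {eb : β → List Sym}
    (ha : PrefixCode ea) (hb : PrefixCode eb) : PrefixCode (encPair ea eb) := by
  rintro ⟨a, b⟩ ⟨a', b'⟩ s t h
  simp only [encPair, List.append_assoc] at h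
  obtain ⟨h1, h2⟩ := ha _ _ _ _ h
  obtain ⟨h3, h4⟩ := hb _ _ _ _ h2
  exact ⟨by rw [h1, h3], h4⟩

theorem prefixCode_encList {α : Type} {ea : α → List Sym} (ha : PrefixCode ea) :
    PrefixCode (encList ea) := by
  intro l
  induction l with
  | nil =>
    intro l' s t h
    cases l' with
    | nil => simpa [encList] using h
    | cons b l' => simp [encList] at h
  | cons a l ih =>
    intro l' s t h
    cases l' with
    | nil => simp [encList] at h
    | cons b l' =>
      have h' : ea a ++ (encList ea l ++ s) = ea b ++ (encList ea l' ++ t) := by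
        simpa [encList] using h
      obtain ⟨h1, h2⟩ := ha _ _ _ _ h'
      obtain ⟨h3, h4⟩ := ih l' s t h2
      exact ⟨by rw [h1, h3], h4⟩

theorem FinGraph.matrix_injective : Function.Injective FinGraph.matrix := by
  rintro ⟨n, G⟩ ⟨m, H⟩ h
  have hn : n = m := by simpa [FinGraph.matrix] using congrArg List.length h
  subst hn
  have h2 := List.ofFn_injective h
  congr 1
  ext u v
  simpa using congrFun (List.ofFn_injective (congrFun h2 u)) v

theorem prefixCode_encGraph : PrefixCode encGraph := by
  intro G H s t h
  obtain ⟨h1, h2⟩ := prefixCode_encList (prefixCode_encList prefixCode_encBool) _ _ _ _ h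
  exact ⟨FinGraph.matrix_injective h1, h2⟩

theorem prefixCode_encNats : PrefixCode encNats := prefixCode_encList prefixCode_encNat

theorem prefixCode_encMining : PrefixCode encMining :=
  prefixCode_encPair (prefixCode_encPair prefixCode_encNat prefixCode_encNat)
    (prefixCode_encList prefixCode_encNats)

theorem prefixCode_encPacking : PrefixCode encPacking :=
  prefixCode_encList (prefixCode_encPair prefixCode_encNats (prefixCode_encList
    (prefixCode_encPair prefixCode_encNats (prefixCode_encPair prefixCode_encNat
      prefixCode_encNat))))

/-- `f` is computable by a multi-stack Turing machine in time polynomial in the length of the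
encoded input. -/
def PolyTimeComputable {α β : Type} (ea : α → List Sym) (eb : β → List Sym) (f : α → β) : Prop :=
  Nonempty (Turing.TM2ComputableInPolyTime ea eb f)

end ChangeProfilePacking

namespace ChangeProfilePacking

open Turing Computability

/-! Add to `G` a vertex adjacent to all others. The new graph has `N = n + 1 > 0` vertices, so the
database is nonempty even for the empty graph; the price is one more color. Each vertex `u` becomes
two items, `2 * u` and its copy `2 * u + 1`. The transactions are chosen so that every item has
support `N + 2`, while `{2 * u, 2 * v + 1}` has support 2 if `u = v`, 1 if `u` and `v` are adjacent,
and 0 otherwise. The threshold is the frequency of one transaction.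

The profile of `{2 * u}` is then the closed neighborhood of `u`, read on the copies, with value `2 /
(N + 2)` at `u` itself and `1 / (N + 2)` at its neighbors. Adjacent `u` and `v` disagree at the copy
of `u`; distinct nonadjacent ones share only common neighbors, where the values coincide. The copies
behave in the same way, on domains disjoint from those of the vertices. Pairs have empty profiles,
which agree with everything. The profile of `∅` has the constant value `1 / (2 * N)` and conflicts
with every vertex. Hence the least number of groups is the chromatic number of the augmented graph
plus one, that is, the chromatic number of `G` plus two. Conversely, the first `n` labels of any
packing color `G`, and they miss the two distinct labels of the added vertex and of `∅`. This is
carried by `support_pair`, `not_agree_vertex`, `agree_vertex`, `not_agree_empty`,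
`packable_of_coloring` and `isProperLabeling_take`.

For polynomial time, structured programs are compiled into stack machines, and `Exec` records timed
runs. The instance is printed in a fixed number of passes through the augmented adjacency matrix,
which fill templates from unary counters holding `N`, `2 * u` and `2 * v`
(`polyTimeComputable_of_passes`, `encode_reduction`). The map back truncates a list of labels
(`polyTimeComputable_take`). -/

/-! ### A structured language for stack machines -/

/-- Structured programs that act on a family of stacks over the alphabet `Sym`. -/
inductive Prog (K : Type) : Type
  /-- do nothing -/
  | skip : Prog K
  /-- push a fixed symbol -/
  | push : K → Sym → Prog K
  /-- remove the top symbol -/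
  | pop : K → Prog K
  /-- move the top symbol from the first stack to the second -/
  | move : K → K → Prog K
  /-- sequential composition -/
  | seq : Prog K → Prog K → Prog K
  /-- branch on the top symbol -/
  | ite : K → (Option Sym → Bool) → Prog K → Prog K → Prog K
  /-- repeat as long as the top symbol satisfies a condition -/
  | loop : K → (Option Sym → Bool) → Prog K → Prog K

namespace Prog

variable {K : Type}

/-- The control points of a program. -/
def Label : Prog K → Type
  | skip => Unit
  | push _ _ => Unit
  | pop _ => Unit
  | move _ _ => Unit
  | seq p q => p.Label ⊕ q.Label
  | ite _ _ p q => Option (p.Label ⊕ q.Label)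
  | loop _ _ p => Option p.Label

/-- There are finitely many control points. -/
noncomputable instance fintypeLabel : (p : Prog K) → Fintype p.Label
  | skip => inferInstanceAs (Fintype Unit)
  | push _ _ => inferInstanceAs (Fintype Unit)
  | pop _ => inferInstanceAs (Fintype Unit)
  | move _ _ => inferInstanceAs (Fintype Unit)
  | seq p q =>
    have := fintypeLabel p
    have := fintypeLabel q
    inferInstanceAs (Fintype (p.Label ⊕ q.Label))
  | ite _ _ p q =>
    have := fintypeLabel p
    have := fintypeLabel q
    inferInstanceAs (Fintype (Option (p.Label ⊕ q.Label)))
  | loop _ _ p =>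
    have := fintypeLabel p
    inferInstanceAs (Fintype (Option p.Label))

/-- The control point at which a program starts. -/
def entry : (p : Prog K) → p.Label
  | skip => ()
  | push _ _ => ()
  | pop _ => ()
  | move _ _ => ()
  | seq p _ => Sum.inl p.entry
  | ite _ _ _ _ => none
  | loop _ _ _ => none

/-- Statements of a stack machine that remembers one symbol. -/
abbrev Code (K Λ : Type) := TM2.Stmt (fun _ : K => Sym) Λ (Option Sym)

/-- The machine code of a program whose control points are embedded by `e` into the labels of a
machine, and that continues at the label `x` when it is finished. -/
def code {Λ : Type} : (p : Prog K) → (p.Label → Λ) → Λ → p.Label → Code K Λ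
  | skip, _, x, _ => .goto fun _ => x
  | push k s, _, x, _ => .push k (fun _ => s) (.goto fun _ => x)
  | pop k, _, x, _ => .pop k (fun v _ => v) (.goto fun _ => x)
  | move k k', _, x, _ =>
    -- The default `Γ'.blank` would be pushed if the source were empty; `Exec.move` is stated only
    -- for a nonempty source.
    .pop k (fun _ o => o) (.push k' (fun v => v.getD Γ'.blank) (.goto fun _ => x))
  | seq p q, e, _, .inl l => p.code (e ∘ Sum.inl) (e (.inr q.entry)) l
  | seq _ q, e, x, .inr l => q.code (e ∘ Sum.inr) x l
  | ite k c p q, e, _, none =>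
    .peek k (fun _ o => o) (.branch c (.goto fun _ => e (some (.inl p.entry)))
      (.goto fun _ => e (some (.inr q.entry))))
  | ite _ _ p _, e, x, some (.inl l) => p.code (fun l => e (some (.inl l))) x l
  | ite _ _ _ q, e, x, some (.inr l) => q.code (fun l => e (some (.inr l))) x l
  | loop k c p, e, x, none =>
    .peek k (fun _ o => o) (.branch c (.goto fun _ => e (some p.entry)) (.goto fun _ => x))
  | loop _ _ p, e, _, some l => p.code (fun l => e (some l)) (e none) l

/-- The contents of the stacks. -/
abbrev Stacks (K : Type) := K → List Sym

variable [DecidableEq K]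

/-- The machine `M` goes from `c` to `c'` in `n` steps. -/
def Steps {Λ : Type} (M : Λ → Code K Λ) (n : ℕ)
    (c c' : TM2.Cfg (fun _ : K => Sym) Λ (Option Sym)) : Prop :=
  (flip bind (TM2.step M))^[n] (some c) = some c'

theorem Steps.trans {Λ : Type} {M : Λ → Code K Λ} {m n : ℕ}
    {c₁ c₂ c₃ : TM2.Cfg (fun _ : K => Sym) Λ (Option Sym)}
    (h₁ : Steps M m c₁ c₂) (h₂ : Steps M n c₂ c₃) : Steps M (m + n) c₁ c₃ := by
  unfold Steps at *
  rw [add_comm, Function.iterate_add_apply, h₁, h₂]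

theorem Steps.single {Λ : Type} {M : Λ → Code K Λ} {l : Λ} {v : Option Sym} {S : Stacks K}
    {c : TM2.Cfg (fun _ : K => Sym) Λ (Option Sym)} (h : TM2.stepAux (M l) v S = c) :
    Steps M 1 ⟨some l, v, S⟩ c := by
  simp [Steps, flip, TM2.step, h]

/-- The program `p` takes the stacks from `S` to `S'` in at most `t` steps, in every machine that
contains its code. -/
def Exec (p : Prog K) (S S' : Stacks K) (t : ℕ) : Prop :=
  ∀ (Λ : Type) (M : Λ → Code K Λ) (e : p.Label → Λ) (x : Λ), (∀ l, M (e l) = p.code e x l) →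
    ∀ v, ∃ v' n, n ≤ t ∧ Steps M n ⟨some (e p.entry), v, S⟩ ⟨some x, v', S'⟩

theorem Exec.mono {p : Prog K} {S S' : Stacks K} {t t' : ℕ} (h : Exec p S S' t) (ht : t ≤ t') :
    Exec p S S' t' := fun Λ M e x hM v => by
  obtain ⟨v', n, hn, hs⟩ := h Λ M e x hM v
  exact ⟨v', n, hn.trans ht, hs⟩

theorem Exec.skip (S : Stacks K) : Exec .skip S S 1 := fun Λ M e x hM v =>
  ⟨v, 1, le_rfl, .single (by rw [hM]; rfl)⟩

theorem Exec.push (k : K) (s : Sym) (S : Stacks K) :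
    Exec (.push k s) S (Function.update S k (s :: S k)) 1 := fun Λ M e x hM v =>
  ⟨v, 1, le_rfl, .single (by rw [hM]; rfl)⟩

theorem Exec.pop (k : K) (S : Stacks K) :
    Exec (.pop k) S (Function.update S k (S k).tail) 1 := fun Λ M e x hM v =>
  ⟨v, 1, le_rfl, .single (by rw [hM]; rfl)⟩

theorem Exec.move {k k' : K} {S : Stacks K} {s : Sym} {l : List Sym} (h : S k = s :: l)
    (hk : k ≠ k') :
    Exec (.move k k') S (Function.update (Function.update S k l) k' (s :: S k')) 1 :=
  fun Λ M e x hM v =>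
  ⟨some s, 1, le_rfl, .single (by rw [hM]; simp [code, h, hk.symm])⟩

/-- Because `Exec` speaks of every machine that contains the code, both halves run inside the same
ambient machine: the exit label of `p` is taken to be the entry of `q`. -/
theorem Exec.seq {p q : Prog K} {S S' S'' : Stacks K} {t t' : ℕ} (h : Exec p S S' t)
    (h' : Exec q S' S'' t') : Exec (.seq p q) S S'' (t + t') := fun Λ M e x hM v => by
  obtain ⟨v', n, hn, hs⟩ := h Λ M (e ∘ Sum.inl) (e (.inr q.entry)) (fun l => hM (.inl l)) v
  obtain ⟨v'', n', hn', hs'⟩ := h' Λ M (e ∘ Sum.inr) x (fun l => hM (.inr l)) v'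
  exact ⟨v'', n + n', add_le_add hn hn', hs.trans hs'⟩

theorem Exec.ite_true {k : K} {c : Option Sym → Bool} {p q : Prog K} {S S' : Stacks K} {t : ℕ}
    (hc : c (S k).head? = true) (h : Exec p S S' t) : Exec (.ite k c p q) S S' (1 + t) :=
  fun Λ M e x hM v => by
  obtain ⟨v', n, hn, hs⟩ := h Λ M (fun l => e (some (.inl l))) x
    (fun l => hM (some (.inl l))) (S k).head?
  refine ⟨v', 1 + n, by lia, Steps.trans (.single ?_) hs⟩
  rw [hM]
  simp [code, entry, hc]

theorem Exec.ite_false {k : K} {c : Option Sym → Bool} {p q : Prog K} {S S' : Stacks K} {t : ℕ}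
    (hc : c (S k).head? = false) (h : Exec q S S' t) : Exec (.ite k c p q) S S' (1 + t) :=
  fun Λ M e x hM v => by
  obtain ⟨v', n, hn, hs⟩ := h Λ M (fun l => e (some (.inr l))) x
    (fun l => hM (some (.inr l))) (S k).head?
  refine ⟨v', 1 + n, by lia, Steps.trans (.single ?_) hs⟩
  rw [hM]
  simp [code, entry, hc]

theorem Exec.loop_false {k : K} {c : Option Sym → Bool} {p : Prog K} {S : Stacks K}
    (hc : c (S k).head? = false) : Exec (.loop k c p) S S 1 :=
  fun Λ M e x hM v => by
  refine ⟨(S k).head?, 1, le_rfl, .single ?_⟩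
  rw [hM]
  simp [code, entry, hc]

/-- The body exits to the head of the loop, so the rest of the run is again a run of the same loop.
-/
theorem Exec.loop_true {k : K} {c : Option Sym → Bool} {p : Prog K} {S S' S'' : Stacks K}
    {t t' : ℕ} (hc : c (S k).head? = true) (h : Exec p S S' t)
    (h' : Exec (.loop k c p) S' S'' t') : Exec (.loop k c p) S S'' (1 + t + t') :=
  fun Λ M e x hM v => by
  obtain ⟨v', n, hn, hs⟩ := h Λ M (fun l => e (some l)) (e none)
    (fun l => hM (some l)) (S k).head?
  obtain ⟨v'', n', hn', hs'⟩ := h' Λ M e x hM v'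
  refine ⟨v'', 1 + n + n', by lia, Steps.trans (Steps.trans (.single ?_) hs) hs'⟩
  rw [hM]
  simp [code, entry, hc]

/-- A loop that passes through the states `S 0, …, S m`. -/
theorem Exec.loop {k : K} {c : Option Sym → Bool} {p : Prog K} (S : ℕ → Stacks K) {m t : ℕ}
    (hc : ∀ i < m, c (S i k).head? = true) (hc' : c (S m k).head? = false)
    (h : ∀ i < m, Exec p (S i) (S (i + 1)) t) :
    Exec (.loop k c p) (S 0) (S m) (m * (1 + t) + 1) := by
  induction m generalizing S with
  | zero => simpa using Exec.loop_false hc'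
  | succ m ih =>
    have h1 := ih (fun i => S (i + 1)) (fun i hi => hc _ (by lia)) hc'
      (fun i hi => h _ (by lia))
    exact (Exec.loop_true (hc 0 (by lia)) (h 0 (by lia)) h1).mono (by ring_nf; rfl)

/-! ### From programs to polynomial-time machines -/

/-- The stacks that are empty except for one. -/
def single (k : K) (s : List Sym) : Stacks K := fun j => if j = k then s else []

/-- `initList` and `haltList` describe their stacks by a dependent `if`; this brings them into the
form `single`. -/
theorem dite_eq_single {k k₀ : K} {s : List Sym} {f : k = k₀ → List Sym} (h : ∀ e, f e = s) :
    dite (k = k₀) f (fun _ => []) = single k₀ s k := by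
  by_cases e : k = k₀ <;> simp [single, e, h]

/-- A machine that runs a program and halts. -/
noncomputable def machine [Fintype K] (p : Prog K) (k₀ k₁ : K) : FinTM2 where
  K := K
  k₀ := k₀
  k₁ := k₁
  Γ := fun _ => Sym
  Λ := Option p.Label
  main := some p.entry
  σ := Option Sym
  initialState := none
  Γk₀Fin := inferInstanceAs (Fintype Γ')
  m := fun
    -- The remembered symbol is reset, since the final configuration must carry the initial state.
    | none => .load (fun _ => none) .halt
    | some l => p.code some none l

theorem polyTimeComputable [Fintype K] {α β : Type} {ea : α → List Sym} {eb : β → List Sym}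
    {f : α → β} (p : Prog K) (k₀ k₁ : K) (time : Polynomial ℕ)
    (h : ∀ a, Exec p (single k₀ (ea a)) (single k₁ (eb (f a))) (time.eval (ea a).length)) :
    PolyTimeComputable ea eb f := by
  -- The additional unit of time pays for the halting step at the label `none`.
  refine ⟨⟨⟨machine p k₀ k₁, Equiv.refl _, Equiv.refl _⟩, time + 1, fun a => Nonempty.some ?_⟩⟩
  obtain ⟨v', n, hn, hs⟩ := h a _ (machine p k₀ k₁).m some none (fun l => rfl) none
  have hf := hs.trans (Steps.single (M := (machine p k₀ k₁).m)
    (c := ⟨none, none, single k₁ (eb (f a))⟩) rfl)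
  refine ⟨⟨⟨n + 1, ?_⟩, ?_⟩⟩
  · have h1 : initList (machine p k₀ k₁) (List.map (Equiv.refl Sym).invFun (ea a)) =
        ⟨some (some p.entry), none, single k₀ (ea a)⟩ := by
      simp only [initList]
      congr 1
      exact funext fun k => dite_eq_single (fun _ => List.map_id _)
    have h2 : haltList (machine p k₀ k₁) (List.map (Equiv.refl Sym).invFun (eb (f a))) =
        ⟨none, none, single k₁ (eb (f a))⟩ := by
      simp only [haltList]
      congr 1
      exact funext fun k => dite_eq_single (fun _ => List.map_id _)
    exact (congrArg (fun c => (flip bind (TM2.step (machine p k₀ k₁).m))^[n + 1] (some c)) h1).trans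
      (Eq.trans hf (congrArg some h2.symm))
  · simpa using hn

end Prog

/-! ### Programs that print templates -/

/-- The stacks: input, matrix, three unary counters, scratch space and output. -/
inductive Reg
  | inp | mat | cn | cu | cv | tmp | out
  deriving DecidableEq

instance : Fintype Reg :=
  ⟨{.inp, .mat, .cn, .cu, .cv, .tmp, .out}, fun k => by cases k <;> simp⟩

/-- Stack contents, listed. -/
def st (i m n u v t w : List Sym) : Prog.Stacks Reg
  | .inp => i
  | .mat => m
  | .cn => n
  | .cu => u
  | .cv => v
  | .tmp => t
  | .out => w

section st
variable (i m n u v t w x : List Sym)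
@[simp] theorem st_inp : st i m n u v t w .inp = i := rfl
@[simp] theorem st_mat : st i m n u v t w .mat = m := rfl
@[simp] theorem st_cn : st i m n u v t w .cn = n := rfl
@[simp] theorem st_cu : st i m n u v t w .cu = u := rfl
@[simp] theorem st_cv : st i m n u v t w .cv = v := rfl
@[simp] theorem st_tmp : st i m n u v t w .tmp = t := rfl
@[simp] theorem st_out : st i m n u v t w .out = w := rfl
@[simp] theorem update_st_inp : Function.update (st i m n u v t w) .inp x = st x m n u v t w := by
  funext k; cases k <;> rfl
@[simp] theorem update_st_mat : Function.update (st i m n u v t w) .mat x = st i x n u v t w := by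
  funext k; cases k <;> rfl
@[simp] theorem update_st_cn : Function.update (st i m n u v t w) .cn x = st i m x u v t w := by
  funext k; cases k <;> rfl
@[simp] theorem update_st_cu : Function.update (st i m n u v t w) .cu x = st i m n x v t w := by
  funext k; cases k <;> rfl
@[simp] theorem update_st_cv : Function.update (st i m n u v t w) .cv x = st i m n u x t w := by
  funext k; cases k <;> rfl
@[simp] theorem update_st_tmp : Function.update (st i m n u v t w) .tmp x = st i m n u v x w := by
  funext k; cases k <;> rfl
@[simp] theorem update_st_out : Function.update (st i m n u v t w) .out x = st i m n u v t x := by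
  funext k; cases k <;> rfl
theorem single_inp : Prog.single .inp i = st i [] [] [] [] [] [] := by
  funext k; cases k <;> rfl
end st

/-- The symbol of which unary numbers consist. -/
abbrev mark : Sym := Γ'.bit true

/-- The unary number `n` without end marker. -/
abbrev ones (n : ℕ) : List Sym := List.replicate n mark

/-- The top symbol exists and is a bit. -/
def isBit : Option Sym → Bool
  | some (.bit _) => true
  | _ => false

/-- The top symbol is `s`. -/
def isSym (s : Sym) (o : Option Sym) : Bool := decide (o = some s)

namespace Prog

variable {K : Type} [DecidableEq K]

theorem Exec.to {p : Prog K} {S S' S'' : Stacks K} {t : ℕ} (h : Exec p S S' t) (e : S' = S'') :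
    Exec p S S'' t := e ▸ h

/-- Move symbols from `k` to `k'` as long as they satisfy `c`. -/
def moveWhile (k k' : K) (c : Option Sym → Bool) : Prog K := .loop k c (.move k k')

/-- Empty the stack `k`. -/
def clear (k : K) : Prog K := .loop k Option.isSome (.pop k)

/-- Symbols move one at a time, so the block `l` arrives reversed; each round costs one test and one
move. -/
theorem exec_moveWhile {k k' : K} (hk : k ≠ k') {c : Option Sym → Bool} (l r : List Sym)
    (hl : ∀ s ∈ l, c (some s) = true) (hr : c r.head? = false) (S : Stacks K)
    (hS : S k = l ++ r) :
    Exec (moveWhile k k' c) S (Function.update (Function.update S k r) k' (l.reverse ++ S k'))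
      (2 * l.length + 1) := by
  induction l generalizing S with
  | nil =>
    refine ((Exec.loop_false (by simpa [hS] using hr)).to ?_).mono (by simp)
    funext j
    rcases eq_or_ne j k' with rfl | h1
    · simp
    · rcases eq_or_ne j k with rfl | h2
      · simp [h1, hS]
      · simp [h1, h2]
  | cons s l ih =>
    refine ((Exec.loop_true (by simpa [hS] using hl s) (Exec.move (by simpa using hS) hk)
      (ih (fun s hs => hl s (by simp [hs])) _ (by simp [hk]))).to ?_).mono
        (by simp; lia)
    funext j
    rcases eq_or_ne j k' with rfl | h1
    · simp
    · rcases eq_or_ne j k with rfl | h2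
      · simp [h1]
      · simp [h1, h2]

theorem exec_moveAll {k k' : K} (hk : k ≠ k') (S : Stacks K) :
    Exec (moveWhile k k' Option.isSome) S
      (Function.update (Function.update S k []) k' ((S k).reverse ++ S k'))
      (2 * (S k).length + 1) :=
  exec_moveWhile hk (S k) [] (by simp) rfl S (by simp)

theorem exec_clear (k : K) (S : Stacks K) :
    Exec (clear k) S (Function.update S k []) (2 * (S k).length + 1) := by
  generalize h : S k = l
  induction l generalizing S with
  | nil => exact ((Exec.loop_false (by simp [h])).to (by simp [← h])).mono (by simp)
  | cons s l ih =>
    exact ((Exec.loop_true (by simp [h]) (Exec.pop k S) (ih _ (by simp [h]))).to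
      (by simp)).mono (by simp; lia)

end Prog

open Prog

section st
variable {s : Sym} {i m n u v t w : List Sym}

theorem exec_push_cu : Exec (.push .cu s) (st i m n u v t w) (st i m n (s :: u) v t w) 1 :=
  (Exec.push _ _ _).to (by simp)

theorem exec_push_cv : Exec (.push .cv s) (st i m n u v t w) (st i m n u (s :: v) t w) 1 :=
  (Exec.push _ _ _).to (by simp)

theorem exec_push_cn : Exec (.push .cn s) (st i m n u v t w) (st i m (s :: n) u v t w) 1 :=
  (Exec.push _ _ _).to (by simp)

theorem exec_push_out : Exec (.push .out s) (st i m n u v t w) (st i m n u v t (s :: w)) 1 :=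
  (Exec.push _ _ _).to (by simp)

theorem exec_pop_inp : Exec (.pop .inp) (st (s :: i) m n u v t w) (st i m n u v t w) 1 :=
  (Exec.pop _ _).to (by simp)

theorem exec_pop_cn : Exec (.pop .cn) (st i m (s :: n) u v t w) (st i m n u v t w) 1 :=
  (Exec.pop _ _).to (by simp)

theorem exec_pop_out : Exec (.pop .out) (st i m n u v t (s :: w)) (st i m n u v t w) 1 :=
  (Exec.pop _ _).to (by simp)

theorem exec_move_mat :
    Exec (.move .mat .inp) (st i (s :: m) n u v t w) (st (s :: i) m n u v t w) 1 :=
  (Exec.move (k := .mat) (k' := .inp) (S := st i (s :: m) n u v t w) rfl (by decide)).to (by simp)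

theorem exec_move_inp :
    Exec (.move .inp .out) (st (s :: i) m n u v t w) (st i m n u v t (s :: w)) 1 :=
  (Exec.move (k := .inp) (k' := .out) (S := st (s :: i) m n u v t w) rfl (by decide)).to (by simp)

theorem exec_clear_cu :
    Exec (clear .cu) (st i m n u v t w) (st i m n [] v t w) (2 * u.length + 1) :=
  (exec_clear _ _).to (by simp)

theorem exec_clear_cv :
    Exec (clear .cv) (st i m n u v t w) (st i m n u [] t w) (2 * v.length + 1) :=
  (exec_clear _ _).to (by simp)

theorem exec_restore : Exec (moveWhile .inp .mat Option.isSome) (st i m n u v t w)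
    (st [] (i.reverse ++ m) n u v t w) (2 * i.length + 1) :=
  (exec_moveAll (by decide) _).to (by simp)

end st

/-- Print the contents of the counter `k`. -/
def printCounter (k : Reg) : Prog Reg :=
  .seq (.loop k Option.isSome (.seq (.move k .tmp) (.push .out mark)))
    (moveWhile .tmp k Option.isSome)

/-- The counter is drained into `.tmp` in `3 * m + 1` steps while marks are printed, and refilled in
`2 * m + 1` steps. All its symbols are equal, so reversal does not matter. -/
theorem exec_printCounter {k : Reg} (hk : k ≠ .tmp) (hk' : k ≠ .out) {S : Stacks Reg} {m : ℕ}
    (hS : S k = ones m) (ht : S .tmp = []) :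
    Exec (printCounter k) S (Function.update S .out (ones m ++ S .out)) (5 * m + 2) := by
  have h1 := Exec.loop (k := k) (c := Option.isSome) (p := .seq (.move k .tmp) (.push .out mark))
    (S := fun i => Function.update (Function.update (Function.update S k (ones (m - i))) .tmp
      (ones i)) .out (ones i ++ S .out)) (m := m) (t := 2)
    (fun i hi => by
      obtain ⟨j, rfl⟩ := Nat.exists_eq_add_of_lt hi
      simp [hk, hk', show i + j + 1 - i = j + 1 by lia, List.replicate_succ])
    (by simp [hk, hk'])
    (fun i hi => by
      obtain ⟨j, rfl⟩ := Nat.exists_eq_add_of_lt hi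
      refine (Exec.seq (Exec.move (s := mark) (l := ones j) ?_ hk) (Exec.push _ _ _)).to ?_
      · simp [hk, hk', show i + j + 1 - i = j + 1 by lia, List.replicate_succ]
      · have : i + j + 1 - (i + 1) = j := by lia
        funext x
        by_cases h1 : x = .out <;> by_cases h2 : x = .tmp <;> by_cases h3 : x = k <;>
          simp_all [Function.update_apply, List.replicate_succ])
  have h0 : Function.update (Function.update (Function.update S k (ones (m - 0))) .tmp
      (ones 0)) .out (ones 0 ++ S .out) = S := by
    funext x
    by_cases h1 : x = .out <;> by_cases h2 : x = .tmp <;> by_cases h3 : x = k <;>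
      simp_all
  rw [h0] at h1
  refine ((Exec.seq h1 (exec_moveAll hk.symm _)).to ?_).mono (by simp; lia)
  funext x
  by_cases h1 : x = .out <;> by_cases h2 : x = .tmp <;> by_cases h3 : x = k <;>
    simp_all

/-- An atom of a template: a symbol, or a reference to a counter. -/
inductive Atom
  | lit (s : Sym) | n | u | v

/-- A pattern for output. -/
abbrev Template := List Atom

/-- The string denoted by an atom for given values of the counters. -/
def Atom.eval (n u v : ℕ) : Atom → List Sym
  | .lit s => [s]
  | .n => ones n
  | .u => ones u
  | .v => ones v

/-- The string denoted by a template for given values of the counters. -/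
def Template.eval (n u v : ℕ) (T : Template) : List Sym := T.flatMap (Atom.eval n u v)

/-- Print an atom. -/
def Atom.print : Atom → Prog Reg
  | .lit s => .push .out s
  | .n => printCounter .cn
  | .u => printCounter .cu
  | .v => printCounter .cv

/-- Print a template. -/
def Template.print : Template → Prog Reg
  | [] => .skip
  | a :: T => .seq a.print (Template.print T)

/-- The output stack has its latest symbol on top, so printed text stays reversed until it is moved
to another stack. The common bound `b` makes the time independent of the atom. -/
theorem Atom.exec_print (a : Atom) {n u v b : ℕ} (hn : n ≤ b) (hu : u ≤ b) (hv : v ≤ b)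
    (i m w : List Sym) :
    Exec a.print (st i m (ones n) (ones u) (ones v) [] w)
      (st i m (ones n) (ones u) (ones v) [] ((a.eval n u v).reverse ++ w)) (5 * b + 2) := by
  cases a with
  | lit s => exact ((Exec.push _ _ _).to (by simp [Atom.eval])).mono (by lia)
  | n =>
    exact ((exec_printCounter (by decide) (by decide) rfl rfl).to
      (by simp [Atom.eval])).mono (by lia)
  | u =>
    exact ((exec_printCounter (by decide) (by decide) rfl rfl).to
      (by simp [Atom.eval])).mono (by lia)
  | v =>
    exact ((exec_printCounter (by decide) (by decide) rfl rfl).to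
      (by simp [Atom.eval])).mono (by lia)

theorem Template.exec_print (T : Template) {n u v b : ℕ} (hn : n ≤ b) (hu : u ≤ b) (hv : v ≤ b)
    (i m w : List Sym) :
    Exec T.print (st i m (ones n) (ones u) (ones v) [] w)
      (st i m (ones n) (ones u) (ones v) [] ((T.eval n u v).reverse ++ w))
      (T.length * (5 * b + 2) + 1) := by
  induction T generalizing w with
  | nil => exact (Exec.skip _).mono (by simp)
  | cons a T ih =>
    exact ((Exec.seq (a.exec_print hn hu hv i m w) (ih _)).to
      (by simp [Template.eval])).mono (by simp; ring_nf; rfl)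

/-! ### Passing through a matrix of bits -/

/-- The row `u` of the `N × N` matrix of bits `a`, as a string. -/
def rowCode (N : ℕ) (a : ℕ → ℕ → Bool) (u : ℕ) : List Sym :=
  (List.range N).map (fun v => Γ'.bit (a u v)) ++ [Γ'.comma]

/-- The `N × N` matrix of bits `a`, as a string. -/
def matrixCode (N : ℕ) (a : ℕ → ℕ → Bool) : List Sym := (List.range N).flatMap (rowCode N a)

/-- Templates for the output of a pass through a matrix: something to be printed at the beginning,
at the start of each row, for each entry, and at the end of each row. -/
structure Pass where
  /-- the beginning -/
  start : Template
  /-- the start of a row -/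
  row : Template
  /-- an entry -/
  cell : Bool → Template
  /-- the end of a row -/
  rowEnd : Template

namespace Pass

/-- The output for one row of a matrix. -/
def rowOutput (N : ℕ) (a : ℕ → ℕ → Bool) (P : Pass) (u : ℕ) : List Sym :=
  P.row.eval N (2 * u) 0 ++
    (List.range N).flatMap (fun v => (P.cell (a u v)).eval N (2 * u) (2 * v)) ++
    P.rowEnd.eval N (2 * u) 0

/-- The output of a pass through a matrix. -/
def output (N : ℕ) (a : ℕ → ℕ → Bool) (P : Pass) : List Sym :=
  P.start.eval N 0 0 ++ (List.range N).flatMap (P.rowOutput N a)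

/-- Treat one entry of the matrix. -/
def printCell (P : Pass) : Prog Reg :=
  .seq (.ite .mat (isSym mark) (P.cell true).print (P.cell false).print)
    -- Two marks per column keep `.cv` at `2 * v`, the item of the vertex `v`. The bit that was read
    -- is saved on `.inp`.
    (.seq (.move .mat .inp) (.seq (.push .cv mark) (.push .cv mark)))

/-- Treat one row of the matrix. -/
def printRow (P : Pass) : Prog Reg :=
  .seq P.row.print (.seq (.loop .mat isBit P.printCell) (.seq (clear .cv)
    (.seq P.rowEnd.print (.seq (.move .mat .inp) (.seq (.push .cu mark) (.push .cu mark))))))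

/-- Pass through the matrix. -/
def print (P : Pass) : Prog Reg :=
  .seq P.start.print (.seq (.loop .mat Option.isSome P.printRow)
    (.seq (clear .cu) (moveWhile .inp .mat Option.isSome)))

/-- A bound for the length of the templates. -/
structure Bounded (P : Pass) (L : ℕ) : Prop where
  start : P.start.length ≤ L
  row : P.row.length ≤ L
  cell : ∀ b, (P.cell b).length ≤ L
  rowEnd : P.rowEnd.length ≤ L

variable {P : Pass} {L N : ℕ} {a : ℕ → ℕ → Bool}

theorem range'_sub {i N : ℕ} (h : i < N) :
    List.range' i (N - i) = i :: List.range' (i + 1) (N - (i + 1)) := by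
  obtain ⟨j, rfl⟩ := Nat.exists_eq_add_of_lt h
  rw [show i + j + 1 - i = j + 1 by lia, show i + j + 1 - (i + 1) = j by lia, List.range'_succ]

theorem exec_template {T : Template} {u v : ℕ} (hT : T.length ≤ L) (hu : u < N) (hv : v < N)
    (i m w : List Sym) :
    Exec T.print (st i m (ones N) (ones (2 * u)) (ones (2 * v)) [] w)
      (st i m (ones N) (ones (2 * u)) (ones (2 * v)) [] ((T.eval N (2 * u) (2 * v)).reverse ++ w))
      (L * (10 * N + 2) + 1) :=
  -- All three counters are at most `2 * N`, which turns `5 * b + 2` into `10 * N + 2`.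
  (T.exec_print (b := 2 * N) (by lia) (by lia) (by lia) i m w).mono (by
    rw [← mul_assoc]
    gcongr
    lia)

theorem exec_printCell (hP : P.Bounded L) {u v : ℕ} (hu : u < N) (hv : v < N) (b : Bool)
    (i m w : List Sym) :
    Exec P.printCell (st i (.bit b :: m) (ones N) (ones (2 * u)) (ones (2 * v)) [] w)
      (st (.bit b :: i) m (ones N) (ones (2 * u)) (ones (2 * (v + 1))) []
        (((P.cell b).eval N (2 * u) (2 * v)).reverse ++ w)) (L * (10 * N + 2) + 5) := by
  have h1 : Exec (.ite .mat (isSym mark) (P.cell true).print (P.cell false).print)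
      (st i (.bit b :: m) (ones N) (ones (2 * u)) (ones (2 * v)) [] w)
      (st i (.bit b :: m) (ones N) (ones (2 * u)) (ones (2 * v)) []
        (((P.cell b).eval N (2 * u) (2 * v)).reverse ++ w)) (1 + (L * (10 * N + 2) + 1)) := by
    cases b with
    | true => exact Exec.ite_true rfl (exec_template (hP.cell _) hu hv _ _ _)
    | false => exact Exec.ite_false rfl (exec_template (hP.cell _) hu hv _ _ _)
  exact ((h1.seq (exec_move_mat.seq (exec_push_cv.seq exec_push_cv))).to
    (by simp [mul_add, List.replicate_succ])).mono (by lia)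

/-- The comma at the end of the row is not a bit and stops the loop. After `j` rounds the first `j`
bits lie reversed on `.inp`, and `.cv` holds `2 * j`. -/
theorem exec_cells (hP : P.Bounded L) {u : ℕ} (hu : u < N) (i m w : List Sym) :
    Exec (.loop .mat isBit P.printCell)
      (st i (rowCode N a u ++ m) (ones N) (ones (2 * u)) [] [] w)
      (st (((List.range N).map (fun v => Γ'.bit (a u v))).reverse ++ i) (.comma :: m) (ones N)
        (ones (2 * u)) (ones (2 * N)) []
        (((List.range N).flatMap
          (fun v => (P.cell (a u v)).eval N (2 * u) (2 * v))).reverse ++ w))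
      (N * (L * (10 * N + 2) + 6) + 1) := by
  have h := Exec.loop (k := .mat) (c := isBit) (p := P.printCell) (m := N)
    (t := L * (10 * N + 2) + 5) (fun j =>
    st (((List.range j).map (fun v => Γ'.bit (a u v))).reverse ++ i)
      ((List.range' j (N - j)).map (fun v => Γ'.bit (a u v)) ++ .comma :: m) (ones N)
        (ones (2 * u)) (ones (2 * j)) []
        (((List.range j).flatMap
          (fun v => (P.cell (a u v)).eval N (2 * u) (2 * v))).reverse ++ w))
    (by
      intro j hj
      simp [range'_sub hj, isBit])
    (by simp [isBit])
    (by
      intro j hj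
      rw [range'_sub hj]
      exact (exec_printCell hP hu hj (a u j) _ _ _).to (by simp [List.range_succ]))
  replace h := h.mono (t' := N * (L * (10 * N + 2) + 6) + 1) (by lia)
  simpa [rowCode, List.range_eq_range'] using h

/-- The number of steps for one row. -/
def rowTime (L N : ℕ) : ℕ := 2 * (L * (10 * N + 2)) + N * (L * (10 * N + 2) + 6) + 4 * N + 8

theorem exec_printRow (hP : P.Bounded L) {u : ℕ} (hu : u < N) (i m w : List Sym) :
    Exec P.printRow
      (st i (rowCode N a u ++ m) (ones N) (ones (2 * u)) [] [] w)
      (st ((rowCode N a u).reverse ++ i) m (ones N) (ones (2 * (u + 1))) [] []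
        ((P.rowOutput N a u).reverse ++ w)) (rowTime L N) := by
  -- Outside the cells `.cv` is empty, which counts as column `0`; `exec_template` requires this
  -- column to be below `N`.
  have hN : 0 < N := by lia
  refine (((exec_template hP.row hu hN _ _ _).seq ((exec_cells hP hu _ _ _).seq
    (exec_clear_cv.seq ((exec_template hP.rowEnd hu hN _ _ _).seq
    (exec_move_mat.seq (exec_push_cu.seq exec_push_cu)))))).to ?_).mono ?_
  · simp [rowCode, rowOutput, mul_add, List.replicate_succ]
  · simp [rowTime]
    lia

/-- The number of steps for a pass. -/
def time (L N : ℕ) : ℕ :=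
  L * (10 * N + 2) + 1 + (N * (1 + rowTime L N) + 1) + (4 * N + 1) + (2 * (N * (N + 1)) + 1)

theorem length_matrixCode (N : ℕ) (a : ℕ → ℕ → Bool) :
    (matrixCode N a).length = N * (N + 1) := by
  simp [matrixCode, rowCode, List.length_flatMap]

/-- The matrix and the counters end as they began, which allows passes to be chained. -/
theorem exec_print (hP : P.Bounded L) (hN : 0 < N) (w : List Sym) :
    Exec P.print (st [] (matrixCode N a) (ones N) [] [] [] w)
      (st [] (matrixCode N a) (ones N) [] [] [] ((P.output N a).reverse ++ w)) (time L N) := by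
  have h1 := Exec.loop (k := .mat) (c := Option.isSome) (p := P.printRow) (m := N)
    (t := rowTime L N) (fun j =>
    st ((List.range j).flatMap (rowCode N a)).reverse
      ((List.range' j (N - j)).flatMap (rowCode N a)) (ones N) (ones (2 * j)) [] []
      (((List.range j).flatMap (P.rowOutput N a)).reverse ++
        ((P.start.eval N 0 0).reverse ++ w)))
    (by
      intro j hj
      simp [range'_sub hj, rowCode])
    (by simp)
    (by
      intro j hj
      rw [range'_sub hj, List.flatMap_cons]
      exact (exec_printRow hP hj _ _ _).to (by simp [List.range_succ]))
  have h0 := exec_template (N := N) hP.start hN hN [] (matrixCode N a) w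
  refine ((h0.seq (Exec.seq (t := N * (1 + rowTime L N) + 1)
    (S' := st (matrixCode N a).reverse [] (ones N) (ones (2 * N)) [] []
      ((P.output N a).reverse ++ w)) ?_ (exec_clear_cu.seq
        exec_restore))).to ?_).mono ?_
  · simpa [matrixCode, output, List.range_eq_range'] using h1
  · simp
  · simp [time, length_matrixCode]
    lia

end Pass

/-- Perform several passes. -/
def printPasses : List Pass → Prog Reg
  | [] => .skip
  | P :: l => .seq P.print (printPasses l)

theorem exec_printPasses {N L : ℕ} {a : ℕ → ℕ → Bool} (l : List Pass)
    (hl : ∀ P ∈ l, P.Bounded L) (hN : 0 < N) (w : List Sym) :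
    Exec (printPasses l) (st [] (matrixCode N a) (ones N) [] [] [] w)
      (st [] (matrixCode N a) (ones N) [] [] [] ((l.flatMap (Pass.output N a)).reverse ++ w))
      (l.length * Pass.time L N + 1) := by
  induction l generalizing w with
  | nil => exact (Exec.skip _).mono (by simp)
  | cons P l ih =>
    exact ((Exec.seq (Pass.exec_print (hl P (by simp)) hN w)
      (ih (fun P hP => hl P (by simp [hP])) _)).to (by simp)).mono (by simp; ring_nf; rfl)

section st
variable {s : Sym} {i m n u v t w : List Sym}

theorem exec_clear_inp :
    Exec (clear .inp) (st i m n u v t w) (st [] m n u v t w) (2 * i.length + 1) :=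
  (exec_clear _ _).to (by simp)

theorem exec_clear_mat :
    Exec (clear .mat) (st i m n u v t w) (st i [] n u v t w) (2 * m.length + 1) :=
  (exec_clear _ _).to (by simp)

theorem exec_clear_cn :
    Exec (clear .cn) (st i m n u v t w) (st i m [] u v t w) (2 * n.length + 1) :=
  (exec_clear _ _).to (by simp)

theorem exec_out_mat : Exec (moveWhile .out .mat Option.isSome) (st i m n u v t w)
    (st i (w.reverse ++ m) n u v t []) (2 * w.length + 1) :=
  (exec_moveAll (by decide) _).to (by simp)

theorem exec_out_inp : Exec (moveWhile .out .inp Option.isSome) (st i m n u v t w)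
    (st (w.reverse ++ i) m n u v t []) (2 * w.length + 1) :=
  (exec_moveAll (by decide) _).to (by simp)

end st

/-! ### Reading a graph -/

/-- The adjacency matrix after a vertex that is adjacent to all others has been added at the end. -/
def augment (n : ℕ) (b : ℕ → ℕ → Bool) (u v : ℕ) : Bool :=
  if u < n ∧ v < n then b u v else decide (u ≠ v)

/-- The first `n` rows and columns of an infinite matrix of bits. -/
def bitRows (n : ℕ) (b : ℕ → ℕ → Bool) : List (List Bool) :=
  (List.range n).map fun u => (List.range n).map (b u)

/-- The contribution of an input symbol to the augmented matrix. -/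
def readSym : Sym → List Sym
  | .bit b => [.bit b]
  | .ket => [mark, .comma]
  | _ => []

/-- Treat one symbol of the input: end every row with an additional bit, and count the rows. -/
def readStep : Prog Reg :=
  .ite .inp isBit (.move .inp .out)
    (.seq (.ite .inp (isSym .ket)
      (.seq (.push .out mark) (.seq (.push .out .comma) (.push .cn mark))) .skip) (.pop .inp))

theorem exec_readStep (s : Sym) (i n w : List Sym) :
    Exec readStep (st (s :: i) [] n [] [] [] w)
      (st i [] (ones (if s = .ket then 1 else 0) ++ n) [] [] [] ((readSym s).reverse ++ w)) 6 := by
  cases s with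
  | bit b => exact ((Exec.ite_true rfl exec_move_inp).to (by simp [readSym])).mono (by lia)
  | ket =>
    exact ((Exec.ite_false rfl (Exec.seq (Exec.ite_true rfl (exec_push_out.seq
      (exec_push_out.seq exec_push_cn))) exec_pop_inp)).to (by simp [readSym])).mono (by lia)
  | _ =>
    exact ((Exec.ite_false rfl (Exec.seq (Exec.ite_false rfl (Exec.skip _))
      exec_pop_inp)).to (by simp [readSym])).mono (by lia)

theorem exec_readLoop (i n w : List Sym) :
    Exec (.loop .inp Option.isSome readStep) (st i [] n [] [] [] w)
      (st [] [] (ones (i.count .ket) ++ n) [] [] [] ((i.flatMap readSym).reverse ++ w))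
      (7 * i.length + 1) := by
  induction i generalizing n w with
  | nil => exact ((Exec.loop_false rfl).to (by simp)).mono (by simp)
  | cons s i ih =>
    refine ((Exec.loop_true rfl (exec_readStep s i n w) (ih _ _)).to ?_).mono (by simp; lia)
    simp only [← List.append_assoc, List.replicate_append_replicate, List.count_cons,
      List.flatMap_cons, List.reverse_append]
    simp

/-- Read a graph, and prepare the augmented adjacency matrix. -/
def readGraph : Prog Reg :=
  -- The outer closing bracket is treated like the end of a row, so a surplus bit, a surplus comma
  -- and a surplus count are removed. Then the row of the added vertex is written: `n` true bits,
  -- and a false one on the diagonal.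
  .seq (.loop .inp Option.isSome readStep) (.seq (.pop .out) (.seq (.pop .out) (.seq (.pop .cn)
    (.seq (printCounter .cn) (.seq (.push .cn mark) (.seq (.push .out (.bit false))
      (.seq (.push .out .comma) (moveWhile .out .mat Option.isSome))))))))

theorem count_encList_encBool (l : List Bool) : (encList encBool l).count .ket = 1 := by
  induction l with
  | nil => rfl
  | cons b l ih => simpa [encList, encBool] using ih

theorem count_bitRows (l : List (List Bool)) :
    (encList (encList encBool) l).count .ket = l.length + 1 := by
  induction l with
  | nil => rfl
  | cons r l ih =>
    have h := count_encList_encBool r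
    simp only [encList, List.flatMap_cons, List.cons_append, List.append_assoc, List.count_cons,
      List.count_append, List.length_cons] at h ih ⊢
    simp at *
    lia

/-- The bracket that closes a row turns into the bit for the edge to the added vertex, followed by
the end of the row. The outer bracket leaves the surplus `[mark, .comma]`. -/
theorem flatMap_readSym (n : ℕ) (b : ℕ → ℕ → Bool) :
    (encList (encList encBool) (bitRows n b)).flatMap readSym =
      (List.range n).flatMap (rowCode (n + 1) (augment n b)) ++ [mark, .comma] := by
  have h (l : List Bool) : (encList encBool l).flatMap readSym = l.map .bit ++ [mark, .comma] := by
    induction l with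
    | nil => rfl
    | cons b l ih => simpa [encList, encBool, readSym] using ih
  have h2 (l : List (List Bool)) : (encList (encList encBool) l).flatMap readSym =
      l.flatMap (fun r => r.map .bit ++ [mark, .comma]) ++ [mark, .comma] := by
    induction l with
    | nil => rfl
    | cons r l ih =>
      have : encList (encList encBool) (r :: l) =
        .bra :: (encList encBool r ++ encList (encList encBool) l) := by simp [encList]
      rw [this, List.flatMap_cons, List.flatMap_append, h, ih]
      simp [readSym]
  rw [h2, bitRows, List.flatMap_map]
  congr 1
  refine List.flatMap_congr fun u hu => ?_
  rw [List.mem_range] at hu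
  simp only [rowCode, List.range_succ, List.map_append, List.map_map, augment]
  simp [hu, hu.ne, -List.map_map]
  intro v hv
  simp [hv]

theorem matrixCode_augment (n : ℕ) (b : ℕ → ℕ → Bool) :
    matrixCode (n + 1) (augment n b) = (List.range n).flatMap (rowCode (n + 1) (augment n b)) ++
      (ones n ++ [.bit false, .comma]) := by
  rw [matrixCode, List.range_succ, List.flatMap_append]
  congr 1
  simp only [List.flatMap_cons, List.flatMap_nil, List.append_nil, rowCode, List.range_succ,
    List.map_append]
  have : (List.range n).map (fun v => Γ'.bit (augment n b n v)) = ones n := by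
    rw [List.eq_replicate_iff]
    simp [augment]
    intro v hv
    lia
  simp only [this]
  simp [augment]

theorem exec_readGraph (n : ℕ) (b : ℕ → ℕ → Bool) :
    Exec readGraph (st (encList (encList encBool) (bitRows n b)) [] [] [] [] [] [])
      (st [] (matrixCode (n + 1) (augment n b)) (ones (n + 1)) [] [] [] [])
      (7 * (encList (encList encBool) (bitRows n b)).length + 1 +
        (5 * n + 2 * ((n + 1) * (n + 2)) + 10)) := by
  have h := exec_readLoop (encList (encList encBool) (bitRows n b)) [] []
  rw [flatMap_readSym, count_bitRows] at h
  simp only [List.reverse_append, List.append_nil, List.reverse_cons, List.reverse_nil,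
    List.nil_append, List.cons_append, bitRows, List.length_map, List.length_range,
    List.replicate_succ] at h
  have hp := (exec_printCounter (k := .cn) (m := n) (by decide) (by decide)
    (S := st [] [] (ones n) [] [] [] ((List.range n).flatMap
      (rowCode (n + 1) (augment n b))).reverse) rfl rfl).to (update_st_out ..)
  refine ((h.seq (exec_pop_out.seq (exec_pop_out.seq (exec_pop_cn.seq (hp.seq (exec_push_cn.seq
    (exec_push_out.seq (exec_push_out.seq exec_out_mat)))))))).to ?_).mono ?_
  · rw [matrixCode_augment]
    simp [List.replicate_succ]
  · have := congrArg List.length (matrixCode_augment n b)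
    rw [Pass.length_matrixCode] at this
    simp only [List.length_append, List.length_replicate, List.length_cons, List.length_nil,
      List.length_reverse, st_out, bitRows] at this ⊢
    lia

/-! ### Printing the results of several passes -/

/-- Read a graph, perform some passes through its augmented adjacency matrix, and output the
result. -/
def matrixProgram (l : List Pass) : Prog Reg :=
  .seq readGraph (.seq (printPasses l) (.seq (clear .mat) (.seq (clear .cn)
    (moveWhile .out .inp Option.isSome))))

theorem Template.length_eval {T : Template} {n u v L N : ℕ} (hT : T.length ≤ L) (hn : n ≤ 2 * N)
    (hu : u ≤ 2 * N) (hv : v ≤ 2 * N) : (T.eval n u v).length ≤ L * (10 * N + 2) := by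
  have h (a : Atom) : (a.eval n u v).length ≤ 10 * N + 2 := by
    cases a <;> simp [Atom.eval] <;> lia
  calc (T.eval n u v).length ≤ T.length * (10 * N + 2) := by
        rw [Template.eval, List.length_flatMap]
        have := List.sum_le_card_nsmul (T.map fun a => (a.eval n u v).length) (10 * N + 2)
          (by simp only [List.mem_map]; rintro _ ⟨a, -, rfl⟩; exact h a)
        simpa using this
    _ ≤ _ := by gcongr

theorem length_flatMap_range_le {N k : ℕ} {f : ℕ → List Sym} (h : ∀ u < N, (f u).length ≤ k) :
    ((List.range N).flatMap f).length ≤ N * k := by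
  rw [List.length_flatMap]
  have := List.sum_le_card_nsmul ((List.range N).map fun a => (f a).length) k
    (by simp only [List.mem_map, List.mem_range]; rintro _ ⟨a, ha, rfl⟩; exact h a ha)
  simpa using this

/-- The final transfer of the output takes time proportional to its length, which therefore has to
be bounded too. -/
theorem Pass.length_output {P : Pass} {L N : ℕ} {a : ℕ → ℕ → Bool} (hP : P.Bounded L) :
    (P.output N a).length ≤ Pass.time L N := by
  have hr (u : ℕ) (hu : u < N) : (P.rowOutput N a u).length ≤ rowTime L N := by
    have h1 := Template.length_eval (n := N) (u := 2 * u) (v := 0) (N := N) hP.row (by lia)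
      (by lia) (by lia)
    have h2 := Template.length_eval (n := N) (u := 2 * u) (v := 0) (N := N) hP.rowEnd (by lia)
      (by lia) (by lia)
    have h3 := length_flatMap_range_le (N := N) (k := L * (10 * N + 2) + 6)
      (f := fun v => (P.cell (a u v)).eval N (2 * u) (2 * v)) fun v hv =>
      (Template.length_eval (N := N) (hP.cell _) (by lia) (by lia) (by lia)).trans (by lia)
    simp only [rowOutput, rowTime, List.length_append]
    lia
  have h1 := Template.length_eval (n := N) (u := 0) (v := 0) (N := N) hP.start (by lia)
      (by lia) (by lia)
  have h2 := length_flatMap_range_le (N := N) (k := 1 + rowTime L N)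
    (f := P.rowOutput N a) fun u hu => (hr u hu).trans (by lia)
  simp only [output, time, List.length_append]
  lia

theorem length_passes {L N : ℕ} {a : ℕ → ℕ → Bool} (l : List Pass) (hl : ∀ P ∈ l, P.Bounded L) :
    (l.flatMap (Pass.output N a)).length ≤ l.length * Pass.time L N := by
  rw [List.length_flatMap]
  have := List.sum_le_card_nsmul (l.map fun P => (P.output N a).length) (Pass.time L N)
    (by simp only [List.mem_map]; rintro _ ⟨P, hP, rfl⟩; exact Pass.length_output (hl P hP))
  simpa using this

/-- The number of steps for the output of several passes, in terms of the length of the input. -/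
def matrixTime (k L x : ℕ) : ℕ :=
  -- One share of `k * Pass.time L x` is for printing; the other two are for moving an output of at
  -- most this length, at two steps per symbol.
  3 * (k * Pass.time L x) + 7 * x + 7 * x + 4 * (x * (x + 1)) + 20

theorem exec_matrixProgram {n L : ℕ} {b : ℕ → ℕ → Bool} (l : List Pass)
    (hl : ∀ P ∈ l, P.Bounded L) :
    Exec (matrixProgram l) (single .inp (encList (encList encBool) (bitRows n b)))
      (single .inp (l.flatMap (Pass.output (n + 1) (augment n b))))
      (matrixTime l.length L (encList (encList encBool) (bitRows n b)).length) := by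
  -- The input has one closing bracket per row and one for the whole matrix, so `N` is at most its
  -- length.
  have hn : n + 1 ≤ (encList (encList encBool) (bitRows n b)).length := by
    have := count_bitRows (bitRows n b)
    simp only [bitRows, List.length_map, List.length_range] at this
    rw [← this]
    exact List.count_le_length
  rw [single_inp, single_inp]
  refine (((exec_readGraph n b).seq ((exec_printPasses l hl (by lia) []).seq
    (exec_clear_mat.seq (exec_clear_cn.seq exec_out_inp)))).to (by simp)).mono ?_
  have h1 := length_passes (N := n + 1) (a := augment n b) l hl
  have h2 : Pass.time L (n + 1) ≤
      Pass.time L (encList (encList encBool) (bitRows n b)).length := by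
    simp only [Pass.time, Pass.rowTime]
    gcongr
  have h3 := Nat.mul_le_mul_left l.length h2
  have h4 : (n + 1) * (n + 1 + 1) ≤ (encList (encList encBool) (bitRows n b)).length *
      ((encList (encList encBool) (bitRows n b)).length + 1) := by
    gcongr
  simp only [Pass.length_matrixCode, List.length_replicate, List.length_reverse,
    List.append_nil, matrixTime] at *
  lia

theorem exists_poly_matrixTime (k L : ℕ) :
    ∃ p : Polynomial ℕ, ∀ x, p.eval x = matrixTime k L x := by
  open Polynomial in
  refine ⟨3 * (C k * (C L * (10 * X + 2) + 1 + (X * (1 + (2 * (C L * (10 * X + 2)) +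
    X * (C L * (10 * X + 2) + 6) + 4 * X + 8)) + 1) + (4 * X + 1) + (2 * (X * (X + 1)) + 1))) +
    7 * X + 7 * X + 4 * (X * (X + 1)) + 20, fun x => ?_⟩
  simp [matrixTime, Pass.time, Pass.rowTime]

/-- The bit for two vertices of a graph. -/
noncomputable def FinGraph.bit (G : FinGraph) (u v : ℕ) : Bool :=
  open Classical in
  decide (∃ (hu : u < G.n) (hv : v < G.n), G.graph.Adj ⟨u, hu⟩ ⟨v, hv⟩)

theorem encGraph_eq (G : FinGraph) : encGraph G = encList (encList encBool) (bitRows G.n G.bit) := by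
  rw [encGraph, FinGraph.matrix, bitRows]
  congr 1
  apply List.ext_getElem
  · simp
  intro u h1 h2
  simp only [List.length_ofFn] at h1
  apply List.ext_getElem
  · simp
  intro v h3 h4
  simp only [List.getElem_ofFn, List.length_ofFn] at h3
  simp [FinGraph.bit, h1, h3]

/-- A function whose value is printed by passes through the augmented adjacency matrix is
computable in polynomial time. -/
theorem polyTimeComputable_of_passes {β : Type} {eb : β → List Sym} {f : FinGraph → β} {L : ℕ}
    (l : List Pass) (hl : ∀ P ∈ l, P.Bounded L)
    (h : ∀ G, eb (f G) = l.flatMap (Pass.output (G.n + 1) (augment G.n G.bit))) :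
    PolyTimeComputable encGraph eb f := by
  obtain ⟨p, hp⟩ := exists_poly_matrixTime l.length L
  refine polyTimeComputable (matrixProgram l) .inp .inp p fun G => ?_
  rw [h, hp, encGraph_eq]
  exact exec_matrixProgram l hl

/-! ### Taking the first labels -/

/-- Skip the encoding of a graph, and count its rows. -/
def skipGraph : Prog Reg :=
  .seq (.loop .inp (isSym .bra) (.seq (.pop .inp) (.seq
    (.loop .inp (isSym .bra) (.seq (.pop .inp) (.pop .inp))) (.seq (.pop .inp) (.push .cn mark)))))
    (.pop .inp)

theorem exec_skipRow (r : List Bool) (s n : List Sym) :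
    Exec (.loop .inp (isSym .bra) (.seq (.pop .inp) (.pop .inp)))
      (st (encList encBool r ++ s) [] n [] [] [] []) (st (.ket :: s) [] n [] [] [] [])
      (3 * r.length + 1) := by
  induction r with
  | nil => exact Exec.loop_false rfl
  | cons b r ih =>
    exact (Exec.loop_true rfl (exec_pop_inp.seq exec_pop_inp) ih).mono (by simp; lia)

theorem exec_skipRows (l : List (List Bool)) (s : List Sym) (n : ℕ) :
    Exec (.loop .inp (isSym .bra) (.seq (.pop .inp) (.seq
      (.loop .inp (isSym .bra) (.seq (.pop .inp) (.pop .inp)))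
        (.seq (.pop .inp) (.push .cn mark)))))
      (st (encList (encList encBool) l ++ s) [] (ones n) [] [] [] [])
      (st (.ket :: s) [] (ones (n + l.length)) [] [] [] [])
      (3 * (encList (encList encBool) l).length) := by
  induction l generalizing n with
  | nil => exact (Exec.loop_false rfl).mono (by simp [encList])
  | cons r l ih =>
    have e : encList (encList encBool) (r :: l) ++ s =
        .bra :: (encList encBool r ++ (encList (encList encBool) l ++ s)) := by simp [encList]
    have e' : (encList encBool r).length = 2 * r.length + 1 := by
      simp [encList, encBool, List.length_flatMap]; lia
    have e'' : (encList (encList encBool) (r :: l)).length =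
        1 + (encList encBool r).length + (encList (encList encBool) l).length := by
      simp [encList]; lia
    rw [e]
    refine ((Exec.loop_true rfl (exec_pop_inp.seq ((exec_skipRow r _ _).seq
      (exec_pop_inp.seq exec_push_cn))) (ih (n + 1))).to (by simp; congr 2; lia)).mono (by lia)

/-- Copy one label. -/
def copyLabel : Prog Reg :=
  .seq (.pop .cn) (.ite .inp (isSym .bra) (.seq (.move .inp .out)
    (.seq (moveWhile .inp .out isBit) (.move .inp .out))) .skip)

theorem exec_copyLabels (n : ℕ) (P : List ℕ) (w : List Sym) :
    Exec (.loop .cn Option.isSome copyLabel) (st (encNats P) [] (ones n) [] [] [] w)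
      (st (encNats (P.drop n)) [] [] [] [] []
        (((P.take n).flatMap (fun x => Γ'.bra :: encNat x)).reverse ++ w))
      (4 * n + 3 * (encNats P).length) := by
  induction n generalizing P w with
  | zero => exact (Exec.loop_false rfl).mono (by simp [encNats, encList]; lia)
  | succ n ih =>
    cases P with
    | nil =>
      -- The labels have run out: the remaining rounds only use up the counter, just as `List.take`
      -- stops at the end of a list.
      refine (Exec.loop_true rfl (exec_pop_cn.seq (Exec.ite_false rfl (Exec.skip _)))
        ((ih [] w).to ?_)).mono (by lia)
      simp
    | cons x P =>
      have e : encNats (x :: P) = .bra :: (ones x ++ .comma :: encNats P) := by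
        simp [encNats, encList, encNat]
      have hm := (exec_moveWhile (k := Reg.inp) (k' := .out) (by decide) (c := isBit) (ones x)
        (.comma :: encNats P) (by simp [isBit]) rfl
        (st (ones x ++ .comma :: encNats P) [] (ones n) [] [] [] (.bra :: w)) rfl)
      rw [update_st_inp, update_st_out] at hm
      rw [e]
      refine ((Exec.loop_true rfl (exec_pop_cn.seq (Exec.ite_true rfl (exec_move_inp.seq
        (hm.seq exec_move_inp)))) (ih P _)).to ?_).mono ?_
      · simp [encNat]
      · simp
        lia

/-- Take as many labels as the graph has vertices. -/
def takeProgram : Prog Reg :=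
  .seq skipGraph (.seq (.loop .cn Option.isSome copyLabel) (.seq (.push .out .ket)
    (.seq (clear .inp) (moveWhile .out .inp Option.isSome))))

theorem length_encNats_take (n : ℕ) (P : List ℕ) :
    (encNats (P.take n)).length ≤ (encNats P).length ∧
      (encNats (P.drop n)).length ≤ (encNats P).length := by
  have h : (P.take n ++ P.drop n).flatMap (fun x => Γ'.bra :: encNat x) =
      P.flatMap fun x => Γ'.bra :: encNat x := by rw [List.take_append_drop]
  have := congrArg List.length h
  rw [List.flatMap_append, List.length_append] at this
  simp only [encNats, encList, List.length_append]
  lia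

theorem polyTimeComputable_take :
    PolyTimeComputable (encPair encGraph encNats) encNats
      (fun p : FinGraph × List ℕ => p.2.take p.1.n) := by
  refine polyTimeComputable takeProgram .inp .inp (20 * Polynomial.X + 20) fun ⟨G, P⟩ => ?_
  have hn : G.n ≤ (encGraph G).length := by
    have := count_bitRows (bitRows G.n G.bit)
    rw [← encGraph_eq] at this
    simp only [bitRows, List.length_map, List.length_range] at this
    have h := List.count_le_length (a := Γ'.ket) (l := encGraph G)
    lia
  have hs := (exec_skipRows (bitRows G.n G.bit) (encNats P) 0)
  rw [← encGraph_eq, zero_add, bitRows, List.length_map, List.length_range] at hs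
  have hl := length_encNats_take G.n P
  rw [single_inp, single_inp, encPair]
  refine (((hs.seq exec_pop_inp).seq (Exec.seq (exec_copyLabels G.n P [])
    (exec_push_out.seq (exec_clear_inp.seq exec_out_inp)))).to ?_).mono ?_
  · simp [encNats, encList]
  · simp [encNats, encList, List.length_flatMap] at hl ⊢
    lia

/-! ### The instances of the reduction -/

/-- The transactions for a matrix of bits. The vertex `u` is represented by the item `2 * u`, and
its copy by the item `2 * u + 1`. -/
def transactions (N : ℕ) (a : ℕ → ℕ → Bool) : List (List ℕ) :=
  (List.range N).flatMap fun u =>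
    -- The repetition separates the value at `u` itself from the values at its neighbors. The empty
    -- transactions are padding that makes the number of transactions independent of `a`.
    [[2 * u, 2 * u + 1], [2 * u, 2 * u + 1], [], []] ++ (List.range N).flatMap fun v =>
      -- In both cases `2 * u` and `2 * v + 1` occur once each, so supports of items do not depend
      -- on degrees.
      if a u v then [[2 * u, 2 * v + 1], []] else [[2 * u], [2 * v + 1]]

/-- The number of transactions. -/
def numTransactions (N : ℕ) : ℕ := N * (4 + N * 2)

/-- The mining instance for a matrix of bits. -/
def matrixMining (N : ℕ) (a : ℕ → ℕ → Bool) : MiningInstance :=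
  ((1, numTransactions N), transactions N a)

/-- The table for the vertex `u`. -/
def vertexTable (N : ℕ) (a : ℕ → ℕ → Bool) (u : ℕ) : ProfileTable :=
  ([2 * u + 1], (2, N + 2)) ::
    (List.range N).flatMap fun v => if a u v then [([2 * v + 1], (1, N + 2))] else []

/-- The table for the copy of the vertex `u`. -/
def copyTable (N : ℕ) (a : ℕ → ℕ → Bool) (u : ℕ) : ProfileTable :=
  ([2 * u], (2, N + 2)) ::
    (List.range N).flatMap fun v => if a u v then [([2 * v], (1, N + 2))] else []

/-- The table for the empty set. -/
def emptyTable (N : ℕ) : ProfileTable :=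
  (List.range N).flatMap fun u => [([2 * u], (1, 2 * N)), ([2 * u + 1], (1, 2 * N))]

/-- The entries for the sets with two elements. -/
def pairEntries (N : ℕ) (a : ℕ → ℕ → Bool) : PackingInstance :=
  (List.range N).flatMap fun u => ([2 * u, 2 * u + 1], []) ::
    (List.range N).flatMap fun v => if a u v then [([2 * u, 2 * v + 1], [])] else []

/-- The packing instance for a matrix of bits. -/
def matrixPacking (N : ℕ) (a : ℕ → ℕ → Bool) : PackingInstance :=
  -- The vertices come first, so that position `u` of a packing is the label of the vertex `u`.
  (List.range N).map (fun u => ([2 * u], vertexTable N a u)) ++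
    ((List.range N).map (fun u => ([2 * u + 1], copyTable N a u)) ++
    (pairEntries N a ++ [([], emptyTable N)]))

/-! ### Printing the instances -/

namespace Template

/-- The opening bracket. -/
abbrev bra : Atom := .lit .bra

/-- The closing bracket. -/
abbrev ket : Atom := .lit .ket

/-- The end of a number. -/
abbrev comma : Atom := .lit .comma

/-- A unit of a number. -/
abbrev one : Atom := .lit mark

/-- The current vertex. -/
def row : Template := [.u, comma]

/-- The copy of the current vertex. -/
def rowCopy : Template := [.u, one, comma]

/-- The vertex of the current column. -/
def col : Template := [.v, comma]

/-- The copy of the vertex of the current column. -/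
def colCopy : Template := [.v, one, comma]

/-- The support of an item. -/
def degree : Template := [.n, one, one, comma]

/-- A set of items. -/
def set (l : List Template) : Template := l.flatMap (bra :: ·) ++ [ket]

end Template

open Template in
/-- The passes that print the mining instance and the packing instance. -/
def reductionPasses : List Pass :=
  -- The threshold: numerator 1, then `4 + N * 2` marks per row add up to `numTransactions N`. The
  -- comma that ends this number starts the next pass; closing brackets of lists are likewise left
  -- to later passes.
  [⟨[one, comma], [one, one, one, one], fun _ => [one, one], []⟩,
    ⟨[comma],
      bra :: set [row, rowCopy] ++ bra :: set [row, rowCopy] ++ bra :: set [] ++ bra :: set [],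
      fun b => if b then bra :: set [row, colCopy] ++ bra :: set []
        else bra :: set [row] ++ bra :: set [colCopy], []⟩,
    ⟨[ket],
      bra :: set [row] ++ bra :: set [rowCopy] ++ one :: one :: comma :: degree,
      fun b => if b then bra :: set [colCopy] ++ one :: comma :: degree else [], [ket]⟩,
    ⟨[],
      bra :: set [rowCopy] ++ bra :: set [row] ++ one :: one :: comma :: degree,
      fun b => if b then bra :: set [col] ++ one :: comma :: degree else [], [ket]⟩,
    ⟨[], bra :: set [row, rowCopy] ++ [ket],
      fun b => if b then bra :: set [row, colCopy] ++ [ket] else [], []⟩,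
    ⟨bra :: set [], bra :: set [row] ++ [one, comma, .n, .n, comma] ++
      bra :: set [rowCopy] ++ [one, comma, .n, .n, comma], fun _ => [], []⟩,
    ⟨[ket, ket], [], fun _ => [], []⟩]

theorem reductionPasses_bounded : ∀ P ∈ reductionPasses, P.Bounded 30 := by
  simp only [reductionPasses, List.forall_mem_cons]
  refine ⟨?_, ?_, ?_, ?_, ?_, ?_, ?_, by simp⟩ <;>
    exact ⟨by decide, by decide, by decide, by decide⟩

/-! ### The printed strings are the encodings of the instances -/

theorem flatMap_ones (N k : ℕ) : (List.range N).flatMap (fun _ => ones k) = ones (N * k) := by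
  induction N with
  | zero => simp
  | succ N ih =>
    simp [List.range_succ, ih, add_mul, List.replicate_append_replicate]

theorem encList_flatMap {α β : Type} (e : α → List Sym) (l : List β) (f : β → List α) :
    encList e (l.flatMap f) = l.flatMap (fun x => (f x).flatMap fun y => .bra :: e y) ++ [.ket] := by
  simp [encList, List.flatMap_assoc]

theorem encList_cons_flatMap {α β : Type} (e : α → List Sym) (x : α) (l : List β)
    (f : β → List α) : encList e (x :: l.flatMap f) =
      .bra :: e x ++ (l.flatMap (fun x => (f x).flatMap fun y => .bra :: e y) ++ [.ket]) := by
  simp [encList, List.flatMap_assoc]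

namespace Template

variable {n u v : ℕ}

@[simp] theorem eval_nil : eval n u v [] = [] := rfl

@[simp] theorem eval_cons (A : Atom) (T : Template) :
    eval n u v (A :: T) = A.eval n u v ++ eval n u v T := rfl

@[simp] theorem eval_append (T T' : Template) :
    eval n u v (T ++ T') = eval n u v T ++ eval n u v T' := List.flatMap_append

@[simp] theorem eval_row : eval n u v row = encNat u := by simp [row, encNat, Atom.eval]

@[simp] theorem eval_rowCopy : eval n u v rowCopy = encNat (u + 1) := by
  simp [rowCopy, encNat, Atom.eval, List.replicate_succ']

@[simp] theorem eval_col : eval n u v col = encNat v := by simp [col, encNat, Atom.eval]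

@[simp] theorem eval_colCopy : eval n u v colCopy = encNat (v + 1) := by
  simp [colCopy, encNat, Atom.eval, List.replicate_succ']

@[simp] theorem eval_degree : eval n u v degree = encNat (n + 2) := by
  simp [degree, encNat, Atom.eval, List.replicate_succ']

@[simp] theorem eval_set (l : List Template) :
    eval n u v (set l) = l.flatMap (fun T => Γ'.bra :: eval n u v T) ++ [Γ'.ket] := by
  simp only [eval, set, List.flatMap_append, List.flatMap_assoc]
  rfl

end Template

section encode
variable (N : ℕ) (a : ℕ → ℕ → Bool)

open Template

theorem encList_transactions : encList encNats (transactions N a) =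
    (List.range N).flatMap (Pass.rowOutput N a ⟨[comma],
      bra :: set [row, rowCopy] ++ bra :: set [row, rowCopy] ++ bra :: set [] ++ bra :: set [],
      fun b => if b then bra :: set [row, colCopy] ++ bra :: set []
        else bra :: set [row] ++ bra :: set [colCopy], []⟩) ++ [.ket] := by
  rw [transactions, encList_flatMap]
  congr 1
  refine List.flatMap_congr fun u _ => ?_
  rw [List.flatMap_append, List.flatMap_assoc]
  simp only [Pass.rowOutput, eval_nil, List.append_nil]
  congr 1
  · simp [encNats, encList, Atom.eval]
  · refine List.flatMap_congr fun v _ => ?_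
    cases a u v <;> simp [encNats, encList, Atom.eval]

theorem encTable_vertex (u : ℕ) : Γ'.bra :: encPair encNats
      (encList (encPair encNats encFraction)) ([2 * u], vertexTable N a u) =
    Pass.rowOutput N a ⟨[ket],
      bra :: set [row] ++ bra :: set [rowCopy] ++ one :: one :: comma :: degree,
      fun b => if b then bra :: set [colCopy] ++ one :: comma :: degree else [], [ket]⟩ u := by
  have h : (List.range N).flatMap (fun v =>
      (if a u v then [([2 * v + 1], (1, N + 2))] else []).flatMap fun y =>
        Γ'.bra :: encPair encNats encFraction y) = (List.range N).flatMap fun v =>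
      Template.eval N (2 * u) (2 * v)
        (if a u v then bra :: set [colCopy] ++ one :: comma :: degree else []) := by
    refine List.flatMap_congr fun v _ => ?_
    cases a u v <;> simp [encNats, encList, Atom.eval, encPair, encFraction, encNat]
  rw [encPair, vertexTable, encList_cons_flatMap, h]
  simp [encNats, encList, Atom.eval, encPair, encFraction, encNat, List.replicate_succ,
    Pass.rowOutput]

theorem encTable_copy (u : ℕ) : Γ'.bra :: encPair encNats
      (encList (encPair encNats encFraction)) ([2 * u + 1], copyTable N a u) =
    Pass.rowOutput N a ⟨[],
      bra :: set [rowCopy] ++ bra :: set [row] ++ one :: one :: comma :: degree,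
      fun b => if b then bra :: set [col] ++ one :: comma :: degree else [], [ket]⟩ u := by
  have h : (List.range N).flatMap (fun v =>
      (if a u v then [([2 * v], (1, N + 2))] else []).flatMap fun y =>
        Γ'.bra :: encPair encNats encFraction y) = (List.range N).flatMap fun v =>
      Template.eval N (2 * u) (2 * v)
        (if a u v then bra :: set [col] ++ one :: comma :: degree else []) := by
    refine List.flatMap_congr fun v _ => ?_
    cases a u v <;> simp [encNats, encList, Atom.eval, encPair, encFraction, encNat]
  rw [encPair, copyTable, encList_cons_flatMap, h]
  simp [encNats, encList, Atom.eval, encPair, encFraction, encNat, List.replicate_succ,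
    Pass.rowOutput]

theorem flatMap_pairEntries : ((pairEntries N a).flatMap fun e => Γ'.bra :: encPair encNats
      (encList (encPair encNats encFraction)) e) =
    (List.range N).flatMap (Pass.rowOutput N a ⟨[], bra :: set [row, rowCopy] ++ [ket],
      fun b => if b then bra :: set [row, colCopy] ++ [ket] else [], []⟩) := by
  rw [pairEntries, List.flatMap_assoc]
  refine List.flatMap_congr fun u _ => ?_
  rw [List.flatMap_cons, List.flatMap_assoc]
  simp only [Pass.rowOutput, eval_nil, List.append_nil]
  congr 1
  · simp [encNats, encList, Atom.eval, encPair]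
  · refine List.flatMap_congr fun v _ => ?_
    cases a u v <;> simp [encNats, encList, Atom.eval, encPair]

theorem encTable_empty : encList (encPair encNats encFraction) (emptyTable N) =
    (List.range N).flatMap (Pass.rowOutput N a ⟨bra :: set [],
      bra :: set [row] ++ [one, comma, .n, .n, comma] ++
      bra :: set [rowCopy] ++ [one, comma, .n, .n, comma], fun _ => [], []⟩) ++ [.ket] := by
  rw [emptyTable, encList_flatMap]
  congr 1
  refine List.flatMap_congr fun u _ => ?_
  simp [encNats, encList, Atom.eval, encPair, encFraction, encNat, Pass.rowOutput, two_mul,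
    ← List.replicate_append_replicate]

theorem encode_reduction :
    encPair encMining encPacking (matrixMining N a, matrixPacking N a) =
      reductionPasses.flatMap (Pass.output N a) := by
  have h1 : (List.range N).flatMap (Pass.rowOutput N a
      ⟨[one, comma], [one, one, one, one], fun _ => [one, one], []⟩) =
      ones (numTransactions N) := by
    have h2 := flatMap_ones N 2
    rw [numTransactions, ← flatMap_ones]
    refine List.flatMap_congr fun u _ => ?_
    have h3 : ones (4 + N * 2) = ones 4 ++ ones (N * 2) := by
      simp [List.replicate_append_replicate]
    rw [h3, ← h2]
    simp [Pass.rowOutput, Atom.eval, List.replicate_succ]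
  rw [encPair, encMining, encPair, matrixMining, encList_transactions, encFraction, encPair,
    encPacking, encList, matrixPacking, List.flatMap_append, List.flatMap_append,
    List.flatMap_append, List.flatMap_map, List.flatMap_map, flatMap_pairEntries]
  simp only [encTable_vertex, encTable_copy]
  rw [List.flatMap_singleton, encPair, encTable_empty N a]
  simp only [encNat, ← h1, reductionPasses, List.flatMap_cons, Pass.output, List.flatMap_nil]
  have hlast : (List.range N).flatMap (Pass.rowOutput N a ⟨[ket, ket], [], fun _ => [], []⟩) = [] := by
    simp [Pass.rowOutput]
  simp [hlast, Atom.eval, encNats, encList]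

end encode

/-! ### Frequencies -/

theorem sum_map_range (N : ℕ) (f : ℕ → ℕ) : ((List.range N).map f).sum = ∑ u ∈ Finset.range N, f u :=
  rfl

/-- Every row that `find?` can return has the right value, and some row is found wherever `p` is
defined; distinct keys are not needed. -/
theorem ProfileTable.profile_eq {T : ProfileTable} {p : ChangeProfile}
    (h₁ : ∀ r ∈ T, p r.1.toFinset = some (Fraction.val r.2))
    (h₂ : ∀ Y q, p Y = some q → ∃ r ∈ T, r.1.toFinset = Y) : ProfileTable.profile T = p := by
  funext Y
  unfold ProfileTable.profile
  cases h : T.find? (fun r => decide (r.1.toFinset = Y)) with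
  | none =>
    rw [List.find?_eq_none] at h
    cases hp : p Y with
    | none => rfl
    | some q =>
      obtain ⟨r, hr, hY⟩ := h₂ Y q hp
      exact absurd (by simpa using hY) (h r hr)
  | some r =>
    have hr := List.mem_of_find?_eq_some h
    have hY := List.find?_some h
    simp only [decide_eq_true_eq] at hY
    rw [← hY, h₁ r hr]
    rfl

theorem simpleSpecializing_eq_some {σ : ℚ} {D : TransactionDB} {X Y : Itemset} {q : ℚ} :
    simpleSpecializing σ D X Y = some q ↔
      ∃ y, Y = {y} ∧ y ∉ X ∧ IsFrequent σ D (X ∪ {y}) ∧ freq D (X ∪ {y}) / freq D X = q := by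
  unfold simpleSpecializing conciseSpecializing specializing
  by_cases h1 : Y.card = 1
  · obtain ⟨y, rfl⟩ := Finset.card_eq_one.1 h1
    by_cases h2 : y ∈ X
    · simp [h2]
    · simp [h2]
  · simp only [h1, if_false, reduceCtorEq, false_iff]
    rintro ⟨y, rfl, -⟩
    simp at h1

section matrix

variable {N : ℕ} {a : ℕ → ℕ → Bool}

/-- The database for a matrix of bits. -/
abbrev matrixDB (N : ℕ) (a : ℕ → ℕ → Bool) : TransactionDB := MiningInstance.db (matrixMining N a)

/-- The threshold for a matrix of bits. -/
abbrev matrixThreshold (N : ℕ) (a : ℕ → ℕ → Bool) : ℚ :=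
  MiningInstance.threshold (matrixMining N a)

theorem length_transactions (N : ℕ) (a : ℕ → ℕ → Bool) :
    (transactions N a).length = numTransactions N := by
  have h (u v : ℕ) : (if a u v then [[2 * u, 2 * v + 1], []] else [[2 * u], [2 * v + 1]]).length =
    2 := by cases a u v <;> rfl
  simp only [transactions, List.length_flatMap, List.length_append, h]
  simp [numTransactions]

theorem support_matrixDB (X : Itemset) : support (matrixDB N a) X =
    ∑ u ∈ Finset.range N,
      ([[2 * u, 2 * u + 1], [2 * u, 2 * u + 1], [], []].countP (fun t => decide (X ⊆ t.toFinset)) +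
      ∑ v ∈ Finset.range N, (if a u v then [[2 * u, 2 * v + 1], []]
        else [[2 * u], [2 * v + 1]]).countP fun t => decide (X ⊆ t.toFinset)) := by
  simp only [support, matrixDB, MiningInstance.db, matrixMining, transactions, List.countP_map,
    List.countP_flatMap, sum_map_range, Function.comp_def, List.countP_append]

/-- The doubled transaction contributes 2, and each of the `N` pairs `(x, v)` contributes exactly
one transaction, adjacent or not. -/
theorem support_vertex {x : ℕ} (hx : x < N) : support (matrixDB N a) {2 * x} = N + 2 := by
  have h (v : ℕ) : 2 * x ≠ 2 * v + 1 := by lia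
  have h1 (u : ℕ) : [[2 * u, 2 * u + 1], [2 * u, 2 * u + 1], [], []].countP
      (fun t => decide ({2 * x} ⊆ t.toFinset)) = if x = u then 2 else 0 := by
    by_cases e : x = u <;> simp [List.countP_cons, e]
    lia
  have h2 (u v : ℕ) : (if a u v then [[2 * u, 2 * v + 1], []] else [[2 * u], [2 * v + 1]]).countP
      (fun t => decide ({2 * x} ⊆ t.toFinset)) = if x = u then 1 else 0 := by
    cases a u v <;> simp [List.countP_cons, h]
  rw [support_matrixDB]
  simp only [h1, h2]
  simp [Finset.sum_add_distrib, hx, add_comm]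

theorem support_copy {x : ℕ} (hx : x < N) : support (matrixDB N a) {2 * x + 1} = N + 2 := by
  have h (v : ℕ) : 2 * x + 1 ≠ 2 * v := by lia
  have h1 (u : ℕ) : [[2 * u, 2 * u + 1], [2 * u, 2 * u + 1], [], []].countP
      (fun t => decide ({2 * x + 1} ⊆ t.toFinset)) = if x = u then 2 else 0 := by
    by_cases e : x = u <;> simp [List.countP_cons, e]
    lia
  have h2 (u v : ℕ) : (if a u v then [[2 * u, 2 * v + 1], []] else [[2 * u], [2 * v + 1]]).countP
      (fun t => decide ({2 * x + 1} ⊆ t.toFinset)) = if x = v then 1 else 0 := by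
    cases a u v <;> simp [List.countP_cons, h]
  rw [support_matrixDB]
  simp only [h1, h2]
  simp [Finset.sum_add_distrib, hx, add_comm]

/-- By parity only transactions equal to `{2 * x, 2 * y + 1}` contain this set. The absence of loops
makes the diagonal count exactly 2. -/
theorem support_pair {x y : ℕ} (hx : x < N) (hy : y < N) (h0 : a x x = false) :
    support (matrixDB N a) {2 * x, 2 * y + 1} =
      if x = y then 2 else if a x y then 1 else 0 := by
  have hp (u v : ℕ) : ({2 * x, 2 * y + 1} : Finset ℕ) ⊆ {2 * u, 2 * v + 1} ↔ x = u ∧ y = v := by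
    simp only [Finset.insert_subset_iff, Finset.singleton_subset_iff, Finset.mem_insert,
      Finset.mem_singleton]
    lia
  have hs (u : ℕ) : ¬ ({2 * x, 2 * y + 1} : Finset ℕ) ⊆ {u} := by
    simp only [Finset.insert_subset_iff, Finset.singleton_subset_iff, Finset.mem_singleton]
    lia
  have h0' : ({2 * x, 2 * y + 1} : Finset ℕ) ≠ ∅ := by simp
  rw [support_matrixDB]
  -- With `X` opaque, `simp` has to decide inclusions by the facts above instead of unfolding them.
  generalize ({2 * x, 2 * y + 1} : Finset ℕ) = X at hp hs h0'
  have h (u v : ℕ) : X ⊆ [2 * u, 2 * v + 1].toFinset ↔ x = u ∧ y = v := by simpa using hp u v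
  have h' (w : ℕ) : ¬ X ⊆ [w].toFinset := by simpa using hs w
  have h1 (u : ℕ) : [[2 * u, 2 * u + 1], [2 * u, 2 * u + 1], [], []].countP
      (fun t => decide (X ⊆ t.toFinset)) = if x = u then (if x = y then 2 else 0) else 0 := by
    by_cases e : x = u
    · subst e
      by_cases e' : x = y
      · simp [-List.toFinset_cons, h, h0', e']
      · simp [-List.toFinset_cons, h, h0', e', Ne.symm e']
    · simp [-List.toFinset_cons, h, h0', e]
  have h2 (u v : ℕ) : (if a u v then [[2 * u, 2 * v + 1], []] else [[2 * u], [2 * v + 1]]).countP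
      (fun t => decide (X ⊆ t.toFinset)) =
      if x = u then (if y = v then (if a x y then 1 else 0) else 0) else 0 := by
    by_cases e : x = u <;> by_cases e' : y = v
    · subst e e'
      cases a x y <;> simp [-List.toFinset_cons, h, h', h0']
    all_goals cases a u v <;> simp [-List.toFinset_cons, h, h', h0', e, e']
  simp only [h1, h2]
  rcases eq_or_ne x y with rfl | e
  · simp [hx, h0]
  · simp [hx, hy, e]

theorem support_empty : support (matrixDB N a) ∅ = numTransactions N := by
  simp [support, MiningInstance.db, matrixMining, length_transactions]

theorem freq_matrixDB (X : Itemset) :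
    freq (matrixDB N a) X = support (matrixDB N a) X / numTransactions N := by
  simp [freq, MiningInstance.db, matrixMining, length_transactions]

theorem numTransactions_pos (hN : 0 < N) : (0 : ℚ) < numTransactions N := by
  simp only [numTransactions]
  positivity

/-- The threshold `1 / numTransactions N` is the frequency of a single transaction. -/
theorem isFrequent_iff_support (hN : 0 < N) {X : Itemset} :
    IsFrequent (matrixThreshold N a) (matrixDB N a) X ↔ 0 < support (matrixDB N a) X := by
  rw [IsFrequent, freq_matrixDB]
  simp only [MiningInstance.threshold, matrixMining, Fraction.val]
  rw [div_le_div_iff_of_pos_right (numTransactions_pos hN)]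
  norm_cast

theorem isFrequent_iff (hN : 0 < N) {X : Itemset} :
    IsFrequent (matrixThreshold N a) (matrixDB N a) X ↔ X = ∅ ∨ (∃ u < N, X = {2 * u}) ∨
      (∃ u < N, X = {2 * u + 1}) ∨
        ∃ u < N, ∃ v < N, (u = v ∨ a u v = true) ∧ X = {2 * u, 2 * v + 1} := by
  rw [isFrequent_iff_support hN, support, List.countP_pos_iff]
  simp only [MiningInstance.db, matrixMining, List.mem_map, exists_exists_and_eq_and,
    decide_eq_true_eq]
  have key (x y : ℕ) : X ⊆ [x, y].toFinset ↔ X = ∅ ∨ X = {x} ∨ X = {y} ∨ X = {x, y} := by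
    have h : [x, y].toFinset = {x, y} := by simp
    rw [h, ← Finset.coe_subset, Finset.coe_insert, Finset.coe_singleton]
    exact_mod_cast Set.subset_pair_iff_eq (s := (X : Set ℕ)) (x := x) (y := y)
  constructor
  · rintro ⟨t, ht, hX⟩
    simp only [transactions, List.mem_flatMap, List.mem_range, List.mem_append] at ht
    obtain ⟨u, hu, ht | ⟨v, hv, ht⟩⟩ := ht
    · simp only [List.mem_cons, List.not_mem_nil, or_false] at ht
      rcases ht with rfl | rfl | rfl | rfl
      · rcases (key _ _).1 hX with h | h | h | h
        exacts [.inl h, .inr (.inl ⟨u, hu, h⟩), .inr (.inr (.inl ⟨u, hu, h⟩)),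
          .inr (.inr (.inr ⟨u, hu, u, hu, .inl rfl, h⟩))]
      · rcases (key _ _).1 hX with h | h | h | h
        exacts [.inl h, .inr (.inl ⟨u, hu, h⟩), .inr (.inr (.inl ⟨u, hu, h⟩)),
          .inr (.inr (.inr ⟨u, hu, u, hu, .inl rfl, h⟩))]
      · exact .inl (by simpa using hX)
      · exact .inl (by simpa using hX)
    · cases e : a u v
      · simp only [e, Bool.false_eq_true, if_false, List.mem_cons, List.not_mem_nil,
          or_false] at ht
        rcases ht with rfl | rfl
        · rcases Finset.subset_singleton_iff.1 (by simpa using hX) with h | h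
          exacts [.inl h, .inr (.inl ⟨u, hu, h⟩)]
        · rcases Finset.subset_singleton_iff.1 (by simpa using hX) with h | h
          exacts [.inl h, .inr (.inr (.inl ⟨v, hv, h⟩))]
      · simp only [e, if_true, List.mem_cons, List.not_mem_nil, or_false] at ht
        rcases ht with rfl | rfl
        · rcases (key _ _).1 hX with h | h | h | h
          exacts [.inl h, .inr (.inl ⟨u, hu, h⟩), .inr (.inr (.inl ⟨v, hv, h⟩)),
            .inr (.inr (.inr ⟨u, hu, v, hv, .inr e, h⟩))]
        · exact .inl (by simpa using hX)
  · have diag (u : ℕ) (hu : u < N) : [2 * u, 2 * u + 1] ∈ transactions N a :=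
      List.mem_flatMap.2 ⟨u, by simpa using hu, by simp⟩
    rintro (h | ⟨u, hu, h⟩ | ⟨u, hu, h⟩ | ⟨u, hu, v, hv, rfl | e, h⟩)
    · exact ⟨_, diag 0 hN, by simp [h]⟩
    · exact ⟨_, diag u hu, by simp [h]⟩
    · exact ⟨_, diag u hu, by simp [h]⟩
    · exact ⟨_, diag u hu, by simp [h]⟩
    · refine ⟨[2 * u, 2 * v + 1], List.mem_flatMap.2 ⟨u, by simpa using hu, ?_⟩, by simp [h]⟩
      exact List.mem_append_right _ (List.mem_flatMap.2 ⟨v, by simpa using hv, by simp [e]⟩)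

/-! ### Profiles -/

/-- The simple specializing change profile of an itemset for a matrix of bits. -/
abbrev matrixProfile (N : ℕ) (a : ℕ → ℕ → Bool) (X : Itemset) : ChangeProfile :=
  simpleSpecializing (matrixThreshold N a) (matrixDB N a) X

theorem pair_frequent {x y : ℕ} (hN : 0 < N) (hxy : x ≠ y) :
    IsFrequent (matrixThreshold N a) (matrixDB N a) ({x} ∪ {y}) ↔
      ∃ u < N, ∃ v < N, (u = v ∨ a u v = true) ∧
        ((x = 2 * u ∧ y = 2 * v + 1) ∨ (y = 2 * u ∧ x = 2 * v + 1)) := by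
  rw [isFrequent_iff hN]
  constructor
  · rintro (h | ⟨u, hu, h⟩ | ⟨u, hu, h⟩ | ⟨u, hu, v, hv, e, h⟩)
    · simp at h
    · have := (Finset.ext_iff.1 h x).1 (by simp)
      have := (Finset.ext_iff.1 h y).1 (by simp)
      simp_all
    · have := (Finset.ext_iff.1 h x).1 (by simp)
      have := (Finset.ext_iff.1 h y).1 (by simp)
      simp_all
    · have h1 := (Finset.ext_iff.1 h x).1 (by simp)
      have h2 := (Finset.ext_iff.1 h y).1 (by simp)
      simp only [Finset.mem_insert, Finset.mem_singleton] at h1 h2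
      exact ⟨u, hu, v, hv, e, by lia⟩
  · rintro ⟨u, hu, v, hv, e, ⟨rfl, rfl⟩ | ⟨rfl, rfl⟩⟩
    · exact .inr (.inr (.inr ⟨u, hu, v, hv, e, rfl⟩))
    · exact .inr (.inr (.inr ⟨u, hu, v, hv, e, Finset.union_comm _ _⟩))

theorem freq_div (hN : 0 < N) (X Y : Itemset) :
    freq (matrixDB N a) X / freq (matrixDB N a) Y =
      support (matrixDB N a) X / support (matrixDB N a) Y := by
  rw [freq_matrixDB, freq_matrixDB, div_div_div_cancel_right₀ (numTransactions_pos hN).ne']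

/-- The value of the profiles of a vertex and of its copy. -/
def pairValue (N : ℕ) (u v : ℕ) : ℚ := (if u = v then 2 else 1) / ((N + 2 : ℕ) : ℚ)

theorem vertexProfile (h0 : ∀ u, a u u = false) {u : ℕ} (hu : u < N) {Y : Itemset} {q : ℚ} :
    matrixProfile N a {2 * u} Y = some q ↔
      ∃ v < N, Y = {2 * v + 1} ∧ (u = v ∨ a u v = true) ∧ pairValue N u v = q := by
  have hN : 0 < N := by lia
  have hval (v : ℕ) (hv : v < N) (e : u = v ∨ a u v = true) :
      freq (matrixDB N a) ({2 * u} ∪ {2 * v + 1}) / freq (matrixDB N a) {2 * u} =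
        pairValue N u v := by
    have h := support_pair (a := a) hu hv (h0 u)
    rw [freq_div hN, support_vertex hu, pairValue]
    change (support (matrixDB N a) {2 * u, 2 * v + 1} : ℚ) / _ = _
    rw [h]
    rcases e with rfl | e
    · simp
    · have : u ≠ v := by rintro rfl; simp [h0] at e
      simp [e, this]
  rw [simpleSpecializing_eq_some]
  constructor
  · rintro ⟨y, rfl, hy, hf, rfl⟩
    simp only [Finset.mem_singleton] at hy
    obtain ⟨u', hu', v, hv, e, h⟩ := (pair_frequent hN (Ne.symm hy)).1 hf
    obtain ⟨rfl, rfl⟩ : u' = u ∧ y = 2 * v + 1 := by lia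
    exact ⟨v, hv, rfl, e, (hval v hv e).symm⟩
  · rintro ⟨v, hv, rfl, e, rfl⟩
    exact ⟨2 * v + 1, rfl, by simp; lia, (pair_frequent hN (by lia)).2
      ⟨u, hu, v, hv, e, .inl ⟨rfl, rfl⟩⟩, hval v hv e⟩

theorem copyProfile (h0 : ∀ u, a u u = false) (hs : ∀ u v, a u v = a v u) {u : ℕ} (hu : u < N)
    {Y : Itemset} {q : ℚ} :
    matrixProfile N a {2 * u + 1} Y = some q ↔
      ∃ v < N, Y = {2 * v} ∧ (u = v ∨ a u v = true) ∧ pairValue N u v = q := by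
  have hN : 0 < N := by lia
  have hval (v : ℕ) (hv : v < N) (e : u = v ∨ a u v = true) :
      freq (matrixDB N a) ({2 * u + 1} ∪ {2 * v}) / freq (matrixDB N a) {2 * u + 1} =
        pairValue N u v := by
    have h := support_pair (a := a) hv hu (h0 v)
    rw [freq_div hN, support_copy hu, pairValue, Finset.union_comm]
    change (support (matrixDB N a) {2 * v, 2 * u + 1} : ℚ) / _ = _
    rw [h]
    rcases e with rfl | e
    · simp
    · have : u ≠ v := by rintro rfl; simp [h0] at e
      rw [hs] at e
      simp [e, this, this.symm]
  rw [simpleSpecializing_eq_some]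
  constructor
  · rintro ⟨y, rfl, hy, hf, rfl⟩
    simp only [Finset.mem_singleton] at hy
    obtain ⟨v, hv, u', hu', e, h⟩ := (pair_frequent hN (Ne.symm hy)).1 hf
    obtain ⟨rfl, rfl⟩ : u' = u ∧ y = 2 * v := by lia
    have e' : u' = v ∨ a u' v = true := e.imp Eq.symm fun e => by rw [hs, e]
    exact ⟨v, hv, rfl, e', (hval v hv e').symm⟩
  · rintro ⟨v, hv, rfl, e, rfl⟩
    exact ⟨2 * v, rfl, by simp; lia, (pair_frequent hN (by lia)).2
      ⟨v, hv, u, hu, e.imp Eq.symm fun e => by rw [hs, e], .inr ⟨rfl, rfl⟩⟩, hval v hv e⟩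

theorem emptyProfile (hN : 0 < N) {Y : Itemset} {q : ℚ} :
    matrixProfile N a ∅ Y = some q ↔
      ∃ u < N, (Y = {2 * u} ∨ Y = {2 * u + 1}) ∧ 1 / ((2 * N : ℕ) : ℚ) = q := by
  have hval (u : ℕ) (y : ℕ) (hu : u < N) (hy : y = 2 * u ∨ y = 2 * u + 1) :
      freq (matrixDB N a) (∅ ∪ {y}) / freq (matrixDB N a) ∅ = 1 / ((2 * N : ℕ) : ℚ) := by
    have h : support (matrixDB N a) {y} = N + 2 := by
      rcases hy with rfl | rfl
      exacts [support_vertex hu, support_copy hu]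
    -- Since `numTransactions N = 2 * N * (N + 2)`, the factor `N + 2` cancels.
    rw [freq_div hN, support_empty, Finset.empty_union, h, numTransactions]
    have : (N : ℚ) ≠ 0 := by positivity
    push_cast
    field_simp
    ring
  rw [simpleSpecializing_eq_some]
  constructor
  · rintro ⟨y, rfl, -, hf, rfl⟩
    rw [Finset.empty_union] at hf
    rcases (isFrequent_iff hN).1 hf with h | ⟨u, hu, h⟩ | ⟨u, hu, h⟩ | ⟨u, hu, v, hv, e, h⟩
    · simp at h
    · rw [Finset.singleton_inj] at h
      exact ⟨u, hu, .inl (by rw [h]), (hval u y hu (.inl h)).symm⟩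
    · rw [Finset.singleton_inj] at h
      exact ⟨u, hu, .inr (by rw [h]), (hval u y hu (.inr h)).symm⟩
    · have := congrArg Finset.card h
      rw [Finset.card_singleton, Finset.card_pair (by lia)] at this
      lia
  · rintro ⟨u, hu, rfl | rfl, rfl⟩
    · exact ⟨2 * u, rfl, by simp, by
        rw [Finset.empty_union, isFrequent_iff hN]
        exact .inr (.inl ⟨u, hu, rfl⟩), hval u _ hu (.inl rfl)⟩
    · exact ⟨2 * u + 1, rfl, by simp, by
        rw [Finset.empty_union, isFrequent_iff hN]
        exact .inr (.inr (.inl ⟨u, hu, rfl⟩)), hval u _ hu (.inr rfl)⟩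

/-- A further item would give a frequent set with three elements, but no transaction has more than
two. -/
theorem pairProfile (hN : 0 < N) (u v : ℕ) (Y : Itemset) :
    matrixProfile N a {2 * u, 2 * v + 1} Y = none := by
  rw [Option.eq_none_iff_forall_ne_some]
  intro q hq
  obtain ⟨y, -, hy, hf, -⟩ := simpleSpecializing_eq_some.1 hq
  have hc : (({2 * u, 2 * v + 1} : Finset ℕ) ∪ {y}).card = 3 := by
    rw [Finset.card_union_of_disjoint (by simpa using hy), Finset.card_pair (by lia)]
    rfl
  rcases (isFrequent_iff hN).1 hf with h | ⟨u, -, h⟩ | ⟨u, -, h⟩ | ⟨u, -, v, -, -, h⟩ <;>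
    rw [h] at hc
  · simp at hc
  · simp at hc
  · simp at hc
  · rw [Finset.card_pair (by lia)] at hc
    lia

end matrix

section matrix

variable {N : ℕ} {a : ℕ → ℕ → Bool}

/-! ### The collection of profiles -/

theorem pair_inj {u v u' v' : ℕ} :
    ({2 * u, 2 * v + 1} : Finset ℕ) = {2 * u', 2 * v' + 1} ↔ u = u' ∧ v = v' := by
  constructor
  · intro h
    have h1 := (Finset.ext_iff.1 h (2 * u)).1 (by simp)
    have h2 := (Finset.ext_iff.1 h (2 * v + 1)).1 (by simp)
    simp only [Finset.mem_insert, Finset.mem_singleton] at h1 h2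
    lia
  · rintro ⟨rfl, rfl⟩
    rfl

theorem mem_pairEntries {e : List ℕ × ProfileTable} : e ∈ pairEntries N a ↔
    ∃ u < N, ∃ v < N, (u = v ∨ a u v = true) ∧ e = ([2 * u, 2 * v + 1], []) := by
  simp only [pairEntries, List.mem_flatMap, List.mem_range, List.mem_cons]
  constructor
  · rintro ⟨u, hu, rfl | ⟨v, hv, h⟩⟩
    · exact ⟨u, hu, u, hu, .inl rfl, rfl⟩
    · cases e : a u v
      · simp [e] at h
      · exact ⟨u, hu, v, hv, .inr e, by simpa [e] using h⟩
  · rintro ⟨u, hu, v, hv, rfl | e, rfl⟩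
    · exact ⟨u, hu, .inl rfl⟩
    · exact ⟨u, hu, .inr ⟨v, hv, by simp [e]⟩⟩

theorem mem_matrixPacking {e : List ℕ × ProfileTable} : e ∈ matrixPacking N a ↔
    (∃ u < N, e = ([2 * u], vertexTable N a u)) ∨ (∃ u < N, e = ([2 * u + 1], copyTable N a u)) ∨
      (∃ u < N, ∃ v < N, (u = v ∨ a u v = true) ∧ e = ([2 * u, 2 * v + 1], [])) ∨
        e = ([], emptyTable N) := by
  simp only [matrixPacking, List.mem_append, mem_pairEntries, List.mem_map, List.mem_range,
    List.mem_singleton, eq_comm (b := e)]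

theorem nodup_pairs (h0 : ∀ u, a u u = false) :
    ((pairEntries N a).map fun e => e.1.toFinset).Nodup := by
  have hN (N : ℕ) : (List.range N).Pairwise (· ≠ ·) := List.nodup_range
  rw [pairEntries, List.map_flatMap, List.nodup_flatMap]
  constructor
  · intro u hu
    rw [List.map_cons, List.nodup_cons, List.map_flatMap, List.nodup_flatMap]
    refine ⟨?_, fun v _ => by cases a u v <;> simp, (hN N).imp fun {v v'} h => ?_⟩
    · simp only [List.mem_flatMap, not_exists, not_and]
      intro v _
      cases e : a u v
      · simp
      · have : u ≠ v := by rintro rfl; simp [h0] at e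
        simpa [pair_inj] using this
    · simp only [Function.onFun]
      cases a u v <;> cases a u v' <;> simp [pair_inj, h.symm]
  · refine (hN N).imp fun {u u'} h => ?_
    simp only [Function.onFun, List.disjoint_left, List.mem_map]
    rintro X ⟨e, he, rfl⟩ ⟨e', he', h'⟩
    have key (u : ℕ) (e : List ℕ × ProfileTable) (he : e ∈ ([2 * u, 2 * u + 1], []) ::
        (List.range N).flatMap fun v => if a u v then [([2 * u, 2 * v + 1], [])] else []) :
        ∃ v, e.1.toFinset = {2 * u, 2 * v + 1} := by
      rw [List.mem_cons] at he
      rcases he with rfl | he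
      · exact ⟨u, by simp⟩
      · obtain ⟨v, -, he⟩ := List.mem_flatMap.1 he
        refine ⟨v, ?_⟩
        cases e' : a u v <;> simp [e'] at he
        simp [he]
    obtain ⟨v, hv⟩ := key u e he
    obtain ⟨v', hv'⟩ := key u' e' he'
    rw [hv, hv', pair_inj] at h'
    exact h h'.1.symm

/-- The four blocks are told apart by cardinality, and vertices from copies by parity. -/
theorem nodup_matrixPacking (h0 : ∀ u, a u u = false) :
    ((matrixPacking N a).map fun e => e.1.toFinset).Nodup := by
  have hp (X : Finset ℕ) (hX : X ∈ (pairEntries N a).map fun e => e.1.toFinset) :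
      ∃ u v, X = {2 * u, 2 * v + 1} := by
    obtain ⟨e, he, rfl⟩ := List.mem_map.1 hX
    obtain ⟨u, -, v, -, -, rfl⟩ := mem_pairEntries.1 he
    exact ⟨u, v, by simp⟩
  have hc (u v w : ℕ) : ({2 * u, 2 * v + 1} : Finset ℕ) ≠ {w} := by
    intro h
    have := congrArg Finset.card h
    rw [Finset.card_pair (by lia), Finset.card_singleton] at this
    lia
  simp only [matrixPacking, List.map_append, List.map_map]
  refine List.Nodup.append ?_ (List.Nodup.append ?_ (List.Nodup.append (nodup_pairs h0) (by simp)
    ?_) ?_) ?_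
  · refine List.nodup_range.map fun u v h => ?_
    simpa using h
  · refine List.nodup_range.map fun u v h => ?_
    simpa using h
  · intro X hX h
    obtain ⟨u, v, rfl⟩ := hp X hX
    simp at h
  · intro X hX h
    obtain ⟨u, -, rfl⟩ := List.mem_map.1 hX
    rcases List.mem_append.1 h with h | h
    · obtain ⟨x, y, e⟩ := hp _ h
      exact hc x y (2 * u + 1) (by simpa using e.symm)
    · simp at h
  · intro X hX h
    obtain ⟨u, -, rfl⟩ := List.mem_map.1 hX
    rcases List.mem_append.1 h with h | h
    · obtain ⟨v, -, e⟩ := List.mem_map.1 h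
      simp at e
      lia
    rcases List.mem_append.1 h with h | h
    · obtain ⟨x, y, e⟩ := hp _ h
      exact hc x y (2 * u) (by simpa using e.symm)
    · simp at h

theorem vertexTable_profile (h0 : ∀ u, a u u = false) {u : ℕ} (hu : u < N) :
    ProfileTable.profile (vertexTable N a u) = matrixProfile N a {2 * u} := by
  have hm (r : List ℕ × Fraction) : r ∈ vertexTable N a u ↔ r = ([2 * u + 1], (2, N + 2)) ∨
      ∃ v < N, a u v = true ∧ r = ([2 * v + 1], (1, N + 2)) := by
    simp only [vertexTable, List.mem_cons, List.mem_flatMap, List.mem_range]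
    refine or_congr_right (exists_congr fun v => and_congr_right fun _ => ?_)
    cases a u v <;> simp
  refine ProfileTable.profile_eq (fun r hr => ?_) fun Y q hY => ?_
  · rw [vertexProfile h0 hu]
    rcases (hm r).1 hr with rfl | ⟨v, hv, e, rfl⟩
    · exact ⟨u, hu, by simp, .inl rfl, by simp [pairValue, Fraction.val]⟩
    · have : u ≠ v := by rintro rfl; simp [h0] at e
      exact ⟨v, hv, by simp, .inr e, by simp [pairValue, Fraction.val, this]⟩
  · obtain ⟨v, hv, rfl, e, -⟩ := (vertexProfile h0 hu).1 hY
    rcases e with rfl | e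
    · exact ⟨_, (hm _).2 (.inl rfl), by simp⟩
    · exact ⟨_, (hm _).2 (.inr ⟨v, hv, e, rfl⟩), by simp⟩

theorem copyTable_profile (h0 : ∀ u, a u u = false) (hs : ∀ u v, a u v = a v u) {u : ℕ}
    (hu : u < N) :
    ProfileTable.profile (copyTable N a u) = matrixProfile N a {2 * u + 1} := by
  have hm (r : List ℕ × Fraction) : r ∈ copyTable N a u ↔ r = ([2 * u], (2, N + 2)) ∨
      ∃ v < N, a u v = true ∧ r = ([2 * v], (1, N + 2)) := by
    simp only [copyTable, List.mem_cons, List.mem_flatMap, List.mem_range]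
    refine or_congr_right (exists_congr fun v => and_congr_right fun _ => ?_)
    cases a u v <;> simp
  refine ProfileTable.profile_eq (fun r hr => ?_) fun Y q hY => ?_
  · rw [copyProfile h0 hs hu]
    rcases (hm r).1 hr with rfl | ⟨v, hv, e, rfl⟩
    · exact ⟨u, hu, by simp, .inl rfl, by simp [pairValue, Fraction.val]⟩
    · have : u ≠ v := by rintro rfl; simp [h0] at e
      exact ⟨v, hv, by simp, .inr e, by simp [pairValue, Fraction.val, this]⟩
  · obtain ⟨v, hv, rfl, e, -⟩ := (copyProfile h0 hs hu).1 hY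
    rcases e with rfl | e
    · exact ⟨_, (hm _).2 (.inl rfl), by simp⟩
    · exact ⟨_, (hm _).2 (.inr ⟨v, hv, e, rfl⟩), by simp⟩

theorem emptyTable_profile (hN : 0 < N) :
    ProfileTable.profile (emptyTable N) = matrixProfile N a ∅ := by
  have hm (r : List ℕ × Fraction) : r ∈ emptyTable N ↔
      ∃ u < N, r = ([2 * u], (1, 2 * N)) ∨ r = ([2 * u + 1], (1, 2 * N)) := by
    simp [emptyTable]
  refine ProfileTable.profile_eq (fun r hr => ?_) fun Y q hY => ?_
  · rw [emptyProfile hN]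
    obtain ⟨u, hu, rfl | rfl⟩ := (hm r).1 hr
    · exact ⟨u, hu, .inl (by simp), by simp [Fraction.val]⟩
    · exact ⟨u, hu, .inr (by simp), by simp [Fraction.val]⟩
  · obtain ⟨u, hu, rfl | rfl, -⟩ := (emptyProfile hN).1 hY
    · exact ⟨_, (hm _).2 ⟨u, hu, .inl rfl⟩, by simp⟩
    · exact ⟨_, (hm _).2 ⟨u, hu, .inr rfl⟩, by simp⟩

theorem isSimpleProfileCollection (h0 : ∀ u, a u u = false) (hs : ∀ u v, a u v = a v u)
    (hN : 0 < N) : IsSimpleProfileCollection (matrixMining N a) (matrixPacking N a) := by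
  refine ⟨nodup_matrixPacking h0, fun X => ?_, fun e he => ?_⟩
  · rw [isFrequent_iff hN]
    simp only [List.mem_map, mem_matrixPacking]
    constructor
    · rintro ⟨e, ⟨u, hu, rfl⟩ | ⟨u, hu, rfl⟩ | ⟨u, hu, v, hv, e, rfl⟩ | rfl, rfl⟩
      · exact .inr (.inl ⟨u, hu, by simp⟩)
      · exact .inr (.inr (.inl ⟨u, hu, by simp⟩))
      · exact .inr (.inr (.inr ⟨u, hu, v, hv, e, by simp⟩))
      · exact .inl (by simp)
    · rintro (rfl | ⟨u, hu, rfl⟩ | ⟨u, hu, rfl⟩ | ⟨u, hu, v, hv, e, rfl⟩)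
      · exact ⟨_, .inr (.inr (.inr rfl)), by simp⟩
      · exact ⟨_, .inl ⟨u, hu, rfl⟩, by simp⟩
      · exact ⟨_, .inr (.inl ⟨u, hu, rfl⟩), by simp⟩
      · exact ⟨_, .inr (.inr (.inl ⟨u, hu, v, hv, e, rfl⟩)), by simp⟩
  · rcases mem_matrixPacking.1 he with ⟨u, hu, rfl⟩ | ⟨u, hu, rfl⟩ | ⟨u, hu, v, hv, e, rfl⟩ | rfl
    · simpa using vertexTable_profile h0 hu
    · simpa using copyTable_profile h0 hs hu
    · funext Y
      simp only [List.toFinset_cons, List.toFinset_nil, insert_empty_eq]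
      exact (pairProfile hN u v Y).symm
    · simpa using emptyTable_profile hN

theorem isLegal (hN : 0 < N) : MiningInstance.IsLegal (matrixMining N a) := by
  have hT := numTransactions_pos hN
  have hT' : 0 < numTransactions N := by exact_mod_cast hT
  refine ⟨fun h => ?_, ?_, ?_⟩
  · have := length_transactions N a
    rw [show transactions N a = [] from h] at this
    simp at this
    lia
  · simp only [MiningInstance.threshold, matrixMining, Fraction.val]
    positivity
  · simp only [MiningInstance.threshold, matrixMining, Fraction.val]
    rw [div_le_one hT]
    exact_mod_cast hT'

/-! ### Agreement of profiles -/

/-- Two change profiles agree on their common domain. -/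
def Agree (p q : ChangeProfile) : Prop := ∀ Y x y, p Y = some x → q Y = some y → x = y

theorem Agree.symm {p q : ChangeProfile} (h : Agree p q) : Agree q p :=
  fun Y x y hx hy => (h Y y x hy hx).symm

/-- The copy of `u` receives `2 / (N + 2)` from `u` but `1 / (N + 2)` from its neighbor `v`. -/
theorem not_agree_vertex (h0 : ∀ u, a u u = false) (hs : ∀ u v, a u v = a v u) {u v : ℕ}
    (hu : u < N) (hv : v < N) (e : a u v = true) :
    ¬ Agree (matrixProfile N a {2 * u}) (matrixProfile N a {2 * v}) := by
  intro h
  have hne : v ≠ u := by rintro rfl; simp [h0] at e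
  have := h {2 * u + 1} _ _ ((vertexProfile h0 hu).2 ⟨u, hu, rfl, .inl rfl, rfl⟩)
    ((vertexProfile h0 hv).2 ⟨u, hu, rfl, .inr (by rw [hs, e]), rfl⟩)
  rw [pairValue, pairValue, if_pos rfl, if_neg hne, div_left_inj' (by positivity)] at this
  norm_num at this

/-- At the copy of `u` the values are `2 / (N + 2)` and `1 / (2 * N)`; equality would mean `4 * N =
N + 2`, which no integer satisfies. -/
theorem not_agree_empty (h0 : ∀ u, a u u = false) {u : ℕ} (hu : u < N) :
    ¬ Agree (matrixProfile N a {2 * u}) (matrixProfile N a ∅) := by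
  intro h
  have hN : 0 < N := by lia
  have := h {2 * u + 1} _ _ ((vertexProfile h0 hu).2 ⟨u, hu, rfl, .inl rfl, rfl⟩)
    ((emptyProfile hN).2 ⟨u, hu, .inr rfl, rfl⟩)
  rw [pairValue, if_pos rfl, div_eq_div_iff (by positivity) (by positivity)] at this
  norm_cast at this
  lia

/-- If `u ≠ v`, a common argument is the copy of some `w` different from both, as otherwise `u` and
`v` would be adjacent. Both values are then `1 / (N + 2)`. -/
theorem agree_vertex (h0 : ∀ u, a u u = false) (hs : ∀ u v, a u v = a v u) {u v : ℕ}
    (hu : u < N) (hv : v < N) (e : a u v = false) :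
    Agree (matrixProfile N a {2 * u}) (matrixProfile N a {2 * v}) := by
  intro Y x y hx hy
  obtain ⟨w, hw, rfl, h, rfl⟩ := (vertexProfile h0 hu).1 hx
  obtain ⟨w', hw', h'', h', rfl⟩ := (vertexProfile h0 hv).1 hy
  obtain rfl : w = w' := by simpa using h''
  rcases eq_or_ne u v with rfl | huv
  · rfl
  have h1 : u ≠ w := by
    rintro rfl
    rw [hs, e] at h'
    simp [huv.symm] at h'
  have h2 : v ≠ w := by
    rintro rfl
    simp [e, huv] at h
  simp [pairValue, h1, h2]

theorem agree_copy (h0 : ∀ u, a u u = false) (hs : ∀ u v, a u v = a v u) {u v : ℕ}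
    (hu : u < N) (hv : v < N) (e : a u v = false) :
    Agree (matrixProfile N a {2 * u + 1}) (matrixProfile N a {2 * v + 1}) := by
  intro Y x y hx hy
  obtain ⟨w, hw, rfl, h, rfl⟩ := (copyProfile h0 hs hu).1 hx
  obtain ⟨w', hw', h'', h', rfl⟩ := (copyProfile h0 hs hv).1 hy
  obtain rfl : w = w' := by simpa using h''
  rcases eq_or_ne u v with rfl | huv
  · rfl
  have h1 : u ≠ w := by
    rintro rfl
    rw [hs, e] at h'
    simp [huv.symm] at h'
  have h2 : v ≠ w := by
    rintro rfl
    simp [e, huv] at h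
  simp [pairValue, h1, h2]

/-- The domains are disjoint: a vertex has odd items as arguments, a copy even ones. This lets a
vertex and its copy share a color. -/
theorem agree_vertex_copy (h0 : ∀ u, a u u = false) (hs : ∀ u v, a u v = a v u) {u v : ℕ}
    (hu : u < N) (hv : v < N) :
    Agree (matrixProfile N a {2 * u}) (matrixProfile N a {2 * v + 1}) := by
  intro Y x y hx hy
  obtain ⟨w, hw, rfl, -⟩ := (vertexProfile h0 hu).1 hx
  obtain ⟨w', hw', h, -⟩ := (copyProfile h0 hs hv).1 hy
  simp at h
  lia

theorem agree_pair (hN : 0 < N) (u v : ℕ) (p : ChangeProfile) :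
    Agree (matrixProfile N a {2 * u, 2 * v + 1}) p := by
  intro Y x y hx
  rw [pairProfile hN] at hx
  cases hx

theorem agree_empty : Agree (matrixProfile N a ∅) (matrixProfile N a ∅) := by
  intro Y x y hx hy
  rw [hx] at hy
  simpa using hy

/-! ### Packings and colorings -/

theorem IsDistance.eq_zero_iff {d : ChangeProfile → ChangeProfile → ℝ} (hd : IsDistance d)
    {p q : ChangeProfile} : d p q = 0 ↔ Agree p q := hd p q

/-- The group of an itemset, if the groups of the vertices and of their copies are given by `c`, and
all other itemsets form one further group `m`. -/
def groupOf (c : ℕ → ℕ) (m : ℕ) : List ℕ → ℕ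
  | [x] => c (x / 2)
  | _ => m

/-- Each color class, together with the copies of its vertices, is a group. One more group takes the
empty set and all pairs, whose profiles are nowhere defined. -/
theorem packable_of_coloring {d : ChangeProfile → ChangeProfile → ℝ} (hd : IsDistance d)
    (h0 : ∀ u, a u u = false) (hs : ∀ u v, a u v = a v u) (hN : 0 < N) {c : ℕ → ℕ} {m : ℕ}
    (hc : ∀ u < N, ∀ v < N, a u v = true → c u ≠ c v) (hm : ∀ u < N, c u < m) :
    Packable d (matrixPacking N a) (m + 1) := by
  have hdiv (u : ℕ) : (2 * u + 1) / 2 = u := by lia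
  refine ⟨(matrixPacking N a).map fun e => groupOf c m e.1, ⟨by simp, fun i j hij => ?_⟩, ?_⟩
  · rw [hd.eq_zero_iff]
    simp only [List.getD_eq_getElem?_getD, List.getElem?_map, Fin.is_lt, getElem?_pos,
      Option.map_some, Option.getD_some] at hij
    have hp (i : Fin (matrixPacking N a).length) : PackingInstance.profile (matrixPacking N a) i =
        matrixProfile N a ((matrixPacking N a).get i).1.toFinset :=
      (isSimpleProfileCollection h0 hs hN).2.2 _ (List.get_mem _ _)
    rw [hp, hp]
    change groupOf c m ((matrixPacking N a).get i).1 =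
      groupOf c m ((matrixPacking N a).get j).1 at hij
    have hi := mem_matrixPacking.1 (List.get_mem (matrixPacking N a) i)
    have hj := mem_matrixPacking.1 (List.get_mem (matrixPacking N a) j)
    generalize (matrixPacking N a).get i = e at *
    generalize (matrixPacking N a).get j = e' at *
    have hcol {u v : ℕ} (hu : u < N) (hv : v < N) (h : c u = c v) : a u v = false := by
      by_contra h'
      exact hc u hu v hv (by simpa using h') h
    rcases hi with ⟨u, hu, rfl⟩ | ⟨u, hu, rfl⟩ | ⟨u, hu, u', hu', -, rfl⟩ | rfl <;>
      rcases hj with ⟨v, hv, rfl⟩ | ⟨v, hv, rfl⟩ | ⟨v, hv, v', hv', -, rfl⟩ | rfl <;>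
      simp only [groupOf, List.toFinset_cons, List.toFinset_nil, insert_empty_eq, hdiv,
        Nat.mul_div_cancel_left _ two_pos] at hij ⊢
    · exact agree_vertex h0 hs hu hv (hcol hu hv hij)
    · exact agree_vertex_copy h0 hs hu hv
    · exact (agree_pair hN _ _ _).symm
    · exact absurd hij (hm u hu).ne
    · exact (agree_vertex_copy h0 hs hv hu).symm
    · exact agree_copy h0 hs hu hv (hcol hu hv hij)
    · exact (agree_pair hN _ _ _).symm
    · exact absurd hij (hm u hu).ne
    · exact agree_pair hN _ _ _
    · exact agree_pair hN _ _ _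
    · exact agree_pair hN _ _ _
    · exact agree_pair hN _ _ _
    · exact absurd hij.symm (hm v hv).ne
    · exact absurd hij.symm (hm v hv).ne
    · exact (agree_pair hN _ _ _).symm
    · exact agree_empty
  · have : ((matrixPacking N a).map fun e => groupOf c m e.1).toFinset ⊆ Finset.range (m + 1) := by
      intro x hx
      rw [List.mem_toFinset, List.mem_map] at hx
      obtain ⟨e, he, rfl⟩ := hx
      rw [Finset.mem_range, Nat.lt_succ_iff]
      rcases mem_matrixPacking.1 he with ⟨u, hu, rfl⟩ | ⟨u, hu, rfl⟩ | ⟨u, hu, v, hv, e, rfl⟩ | rfl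
      · simpa [groupOf] using (hm u hu).le
      · simpa [groupOf, hdiv] using (hm u hu).le
      · exact le_rfl
      · exact le_rfl
    simpa [numLabels] using Finset.card_le_card this

theorem labels_of_isPacking {d : ChangeProfile → ChangeProfile → ℝ} (hd : IsDistance d)
    (h0 : ∀ u, a u u = false) (hs : ∀ u v, a u v = a v u) (hN : 0 < N) {P : List ℕ}
    (hP : IsPacking d (matrixPacking N a) P) :
    N ≤ P.length ∧ (∀ u < N, ∀ v < N, a u v = true → P.getD u 0 ≠ P.getD v 0) ∧
      ∃ x ∈ P, ∀ u < N, P.getD u 0 ≠ x := by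
  have hp (i : Fin (matrixPacking N a).length) : PackingInstance.profile (matrixPacking N a) i =
      matrixProfile N a ((matrixPacking N a).get i).1.toFinset :=
    (isSimpleProfileCollection h0 hs hN).2.2 _ (List.get_mem _ _)
  have hlen : N < (matrixPacking N a).length := by simp [matrixPacking]
  have hget (u : ℕ) (hu : u < N) : (matrixPacking N a).get ⟨u, by lia⟩ =
      ([2 * u], vertexTable N a u) := by
    simp [matrixPacking, hu]
  -- The label at the position `j` of the empty set is the one that no vertex can have.
  obtain ⟨j, hj⟩ := List.get_of_mem (mem_matrixPacking.2 (.inr (.inr (.inr rfl))) :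
    ([], emptyTable N) ∈ matrixPacking N a)
  have hjP : j.1 < P.length := by rw [hP.1]; exact j.2
  refine ⟨by rw [hP.1]; lia, fun u hu v hv e h => ?_, P.getD j 0, ?_, fun u hu h => ?_⟩
  · have := hP.2 ⟨u, by lia⟩ ⟨v, by lia⟩ h
    rw [hd.eq_zero_iff, hp, hp, hget u hu, hget v hv] at this
    exact not_agree_vertex h0 hs hu hv e (by simpa using this)
  · rw [List.getD_eq_getElem _ _ hjP]
    exact List.getElem_mem _
  · have := hP.2 ⟨u, by lia⟩ j h
    rw [hd.eq_zero_iff, hp, hp, hget u hu, hj] at this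
    exact not_agree_empty h0 hu (by simpa using this)

end matrix

/-! ### Graphs -/

theorem augment_self (G : FinGraph) (u : ℕ) : augment G.n G.bit u u = false := by
  simp [augment, FinGraph.bit]

theorem augment_comm (G : FinGraph) (u v : ℕ) :
    augment G.n G.bit u v = augment G.n G.bit v u := by
  have h : G.bit u v = G.bit v u := by
    simp only [FinGraph.bit, decide_eq_decide]
    exact ⟨fun ⟨hu, hv, h⟩ => ⟨hv, hu, h.symm⟩, fun ⟨hv, hu, h⟩ => ⟨hu, hv, h.symm⟩⟩
  simp only [augment, h, and_comm (a := u < G.n), eq_comm (a := u), ne_eq]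

theorem augment_fin (G : FinGraph) (u v : Fin G.n) :
    augment G.n G.bit u v = true ↔ G.graph.Adj u v := by
  simp [augment, FinGraph.bit]

theorem augment_last (G : FinGraph) {u : ℕ} (hu : u < G.n) :
    augment G.n G.bit u G.n = true := by
  simp [augment, hu.ne]

/-- The reduction to frequent itemset mining. -/
noncomputable def FinGraph.mining (G : FinGraph) : MiningInstance :=
  matrixMining (G.n + 1) (augment G.n G.bit)

/-- The reduction to change profile packing. -/
noncomputable def FinGraph.packing (G : FinGraph) : PackingInstance :=
  matrixPacking (G.n + 1) (augment G.n G.bit)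

section graph

variable {G : FinGraph} {d : ChangeProfile → ChangeProfile → ℝ}

theorem packable_of_colorable (hd : IsDistance d) {k : ℕ} (h : G.graph.Colorable k) :
    Packable d G.packing (k + 2) := by
  obtain ⟨c⟩ := h
  refine packable_of_coloring hd (augment_self G) (augment_comm G) (Nat.succ_pos _)
    -- The added vertex receives the new color `k`, so the augmented graph uses `k + 1` colors.
    (c := fun u => if h : u < G.n then (c ⟨u, h⟩ : ℕ) else k) (m := k + 1) ?_ ?_
  · intro u hu v hv e
    by_cases h1 : u < G.n <;> by_cases h2 : v < G.n <;> simp only [h1, h2, dite_true, dite_false]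
    · have := c.valid ((augment_fin G ⟨u, h1⟩ ⟨v, h2⟩).1 e)
      exact fun h => this (Fin.ext h)
    · exact (c ⟨u, h1⟩).2.ne
    · exact (c ⟨v, h2⟩).2.ne'
    · obtain rfl : u = v := by lia
      simp [augment_self] at e
  · intro u _
    by_cases h1 : u < G.n <;> simp only [h1, dite_true, dite_false]
    · have := (c ⟨u, h1⟩).2
      lia
    · lia

theorem getD_take {P : List ℕ} {n u : ℕ} (h : u < n) : (P.take n).getD u 0 = P.getD u 0 := by
  simp [List.getD_eq_getElem?_getD, h]

/-- Truncation loses two labels: that of the empty set, and that of the added vertex, which is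
adjacent to all vertices of `G` and also conflicts with the empty set. -/
theorem isProperLabeling_take (hd : IsDistance d) {P : List ℕ} (hP : IsPacking d G.packing P) :
    IsProperLabeling G (P.take G.n) ∧ numLabels (P.take G.n) + 2 ≤ numLabels P := by
  obtain ⟨hl, hadj, x, hx, hxu⟩ := labels_of_isPacking hd (augment_self G) (augment_comm G)
    (Nat.succ_pos _) hP
  refine ⟨⟨by simp; lia, fun u v h => ?_⟩, ?_⟩
  · rw [getD_take u.2, getD_take v.2]
    exact hadj u (by lia) v (by lia) ((augment_fin G u v).2 h)
  · have hmem {y : ℕ} (hy : y ∈ (P.take G.n).toFinset) : ∃ u < G.n, y = P.getD u 0 := by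
      rw [List.mem_toFinset] at hy
      obtain ⟨u, hu, rfl⟩ := List.getElem_of_mem hy
      have hu' : u < G.n := by simp at hu; lia
      exact ⟨u, hu', by rw [← getD_take hu', List.getD_eq_getElem _ _ hu]⟩
    have h1 : x ∉ (P.take G.n).toFinset := fun h => by
      obtain ⟨u, hu, rfl⟩ := hmem h
      exact hxu u (by lia) rfl
    -- Position `G.n` belongs to the added vertex.
    have h2 : P.getD G.n 0 ∉ insert x (P.take G.n).toFinset := by
      rw [Finset.mem_insert, not_or]
      refine ⟨hxu _ (by lia), fun h => ?_⟩
      obtain ⟨u, hu, e⟩ := hmem h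
      exact hadj u (by lia) G.n (by lia) (augment_last G hu) e.symm
    have h3 : insert (P.getD G.n 0) (insert x (P.take G.n).toFinset) ⊆ P.toFinset := by
      simp only [Finset.insert_subset_iff, List.mem_toFinset]
      refine ⟨?_, hx, fun y hy => ?_⟩
      · rw [List.getD_eq_getElem _ _ (by lia)]
        exact List.getElem_mem _
      · rw [List.mem_toFinset] at hy ⊢
        exact List.mem_of_mem_take hy
    have := Finset.card_le_card h3
    rw [Finset.card_insert_of_notMem h2, Finset.card_insert_of_notMem h1] at this
    exact this

theorem colorable_of_isProperLabeling {c : List ℕ} (h : IsProperLabeling G c) :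
    G.graph.Colorable (numLabels c) := by
  have hc (u : Fin G.n) : c.getD u 0 ∈ c.toFinset := by
    have := h.1
    rw [List.mem_toFinset, List.getD_eq_getElem _ _ (by lia)]
    exact List.getElem_mem _
  have C : G.graph.Coloring c.toFinset :=
    SimpleGraph.Coloring.mk (fun u => ⟨c.getD u 0, hc u⟩) fun {u v} e he =>
      h.2 u v e (congrArg Subtype.val he)
  have h := C.colorable
  rwa [Fintype.card_coe] at h

end graph

end ChangeProfilePacking

open ChangeProfilePacking in
/-- Minimum graph coloring reduces in polynomial time to change profile packing. -/
theorem theoremt :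
    ∃ (mining : FinGraph → MiningInstance) (packing : FinGraph → PackingInstance)
      (back : FinGraph × List ℕ → List ℕ),
      PolyTimeComputable encGraph (encPair encMining encPacking)
        (fun G => (mining G, packing G)) ∧
      PolyTimeComputable (encPair encGraph encNats) encNats back ∧
      ∀ G : FinGraph,
        MiningInstance.IsLegal (mining G) ∧
        IsSimpleProfileCollection (mining G) (packing G) ∧
        ∀ d : ChangeProfile → ChangeProfile → ℝ, IsDistance d →
          (∀ k : ℕ, Packable d (packing G) (k + 2) ↔ G.graph.Colorable k) ∧
          (∀ P : List ℕ, IsPacking d (packing G) P →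
            IsProperLabeling G (back (G, P)) ∧
            ∀ k : ℕ, numLabels P ≤ k + 2 → numLabels (back (G, P)) ≤ k) ∧
          (∀ P : List ℕ, IsOptimalPacking d (packing G) P →
            IsMinimumColoring G (back (G, P))) := by
  refine ⟨FinGraph.mining, FinGraph.packing, fun p => p.2.take p.1.n,
    polyTimeComputable_of_passes reductionPasses reductionPasses_bounded
      (fun G => encode_reduction _ _), polyTimeComputable_take, fun G =>
    ⟨isLegal (Nat.succ_pos _), isSimpleProfileCollection (augment_self G) (augment_comm G)
      (Nat.succ_pos _), fun d hd => ⟨fun k => ⟨?_, packable_of_colorable hd⟩, fun P hP => ?_,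
        fun P hP => ?_⟩⟩⟩
  · rintro ⟨P, hP, hk⟩
    obtain ⟨h1, h2⟩ := isProperLabeling_take hd hP
    exact (colorable_of_isProperLabeling h1).mono (by lia)
  · obtain ⟨h1, h2⟩ := isProperLabeling_take hd hP
    exact ⟨h1, fun k hk => by simp only; lia⟩
  · obtain ⟨h1, h2⟩ := isProperLabeling_take hd hP.1
    refine ⟨h1, fun c hc => ?_⟩
    -- A competing labeling `c` yields a packing `Q` with at most `numLabels c + 2` groups.
    -- Optimality of `P` compares it with `Q`, and the two extra labels cancel.
    obtain ⟨Q, hQ, hk⟩ := packable_of_colorable hd (colorable_of_isProperLabeling hc)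
    have := hP.2 Q hQ
    simp only
    lia
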